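/- **Setting.** Let $U\subseteq\mathbb R^4$ be open with coordinates $x^\mu$, let $g_{\mu\nu}$ be a smooth non-degenerate metric and $\theta^{\mu\nu}$ a smooth non-degenerate Poisson tensor on $U$, with Poisson bracket $\{f,h\}=\theta^{\mu\nu}\partial_\mu f\,\partial_\nu h$. Put $$\rho=\sqrt{\det\theta^{-1}_{\mu\nu}},\qquad G^{\mu\nu}=e^{-\sigma}\theta^{\mu\rho}\theta^{\nu\kappa}g_{\rho\kappa},\qquad e^{-\sigma}=\frac{\rho}{\sqrt{\det G_{\mu\nu}}},$$ and assume $G_{\mu\nu}=g_{\mu\nu}$ (so that $\sqrt g=\sqrt{\det G_{\mu\nu}}$). For Hermitian matrices and Euclidean signature all fields are real and the roots are positive; more generally (time-like matrices being anti-Hermitian) all fields may be complex-valued, the roots and $\sigma$ being smooth functions on $U$ that satisfy these relations. Let $\eta_{ab}$ be a constant real symmetric non-degenerate $D\times D$ matrix, used to lower Latin indices, and let $x^a$, $a=1,\dots,D$, be smooth functions on $U$ which induce $g$, i.e. $g_{\mu\nu}=\partial_\mu x^a\partial_\nu x^b\,\eta_{ab}$. Let $\square_g$, $R_{\mu\rho\eta\alpha}$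 and $R$ be the Laplace–Beltrami operator, the Riemann tensor and the Ricci scalar of $g$, with $[\nabla_\nu,\nabla_\mu]\partial_\lambda=-R_{\nu\mu\lambda}{}^{\kappa}\partial_\kappa$ and $R=g^{\nu\lambda}R_{\nu\mu\lambda}{}^{\mu}$. For matrices $X^a$ put $\square X^a=[X^b,[X_b,X^a]]$ and, for constants $\alpha,\beta$, $$S_6=\mathrm{Tr}\Big(\alpha\,\square X^a\square X_a+\tfrac{\beta}{2}\,[X^c,[X^a,X^b]][X_c,[X_a,X_b]]\Big).$$ Its semi-classical limit $S_6^{\mathrm{sc}}$ is obtained by replacing $X^a$ by $x^a$, every commutator $[\cdot,\cdot]$ by $i\{\cdot,\cdot\}$, products by pointwise products, and $\mathrm{Tr}$ by $(2\pi)^{-2}\int_U d^4x\,\rho$. **Convergence and boundary conditions.** Where indicated below, assume that $\sqrt g\,\partial^\mu e^\sigma$ has no flux through the boundary of $U$ (or through infinity): there are $\chi_k\in C_c^\infty(U)$ with $0\le\chi_k\le1$, $\chi_k\to1$ pointwise on $U$ and $\int_U\sqrt g\,\partial^\mu e^\sigma\,\partial_\mu\chi_k\,d^4x\to0$ (e.g.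 $U=\mathbb R^4$ and $\sigma$ constant outside a compact set), and that the integrals in the formula, including the one defining $S_6^{\mathrm{sc}}$, converge absolutely. **Claim.** (1) Under these conditions $$S_6^{\mathrm{sc}}=\frac{\alpha+\beta}{(2\pi)^2}\int_U d^4x\sqrt g\;e^{\sigma}\,\square_g x^a\,\square_g x_a+\frac{\beta}{(2\pi)^2}\int_U d^4x\sqrt g\,\Big(\tfrac12\theta^{\mu\rho}\theta^{\eta\alpha}R_{\mu\rho\eta\alpha}-2e^\sigma R+2e^\sigma\,\partial^\mu\sigma\,\partial_\mu\sigma\Big).$$ (2) If $\alpha+\beta=0$, then, under the no-flux condition and absolute convergence of the two integrals that occur, $S_6^{\mathrm{sc}}$ equals the second term alone, which involves only $g$ and $\theta$. (3) If $\alpha+\beta=0$, then $S_6^{\mathrm{sc}}$ does not depend on the embedding: any two families $(x^a)_{a\le D}$, $\eta$ and $(x'^{a})_{a\le D'}$, $\eta'$ which induce the same $g$ on the same $(U,\theta)$ give the same value. This needs no boundary or convergence condition (an integral that does not converge absolutely being assigned the value $0$). -/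

import Mathlib

open scoped Matrix

noncomputable section

/-! ### Matrix-model observables and their semi-classical limit -/

/-- Formal observables of a matrix model with `D` matrices `X^a`, built from the `X^a` by
linear combinations, products and commutators. Commutators are kept as a separate operation
because the semi-classical limit is a replacement rule for commutators. -/
inductive MatrixObs (D : ℕ) : Type
  | X (a : Fin D) : MatrixObs D
  | smul (c : ℂ) (A : MatrixObs D) : MatrixObs D
  | add (A B : MatrixObs D) : MatrixObs D
  | sum (A : Fin D → MatrixObs D) : MatrixObs D
  | mul (A B : MatrixObs D) : MatrixObs D
  | comm (A B : MatrixObs D) : MatrixObs D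

namespace MatrixObs

/-- The observable evaluated on actual matrices (operators) `X^a` in a complex algebra. -/
def toAlgebra {D : ℕ} {𝒜 : Type*} [Ring 𝒜] [Algebra ℂ 𝒜] (Y : Fin D → 𝒜) : MatrixObs D → 𝒜
  | X a => Y a
  | smul c A => c • toAlgebra Y A
  | add A B => toAlgebra Y A + toAlgebra Y B
  | sum A => ∑ a, toAlgebra Y (A a)
  | mul A B => toAlgebra Y A * toAlgebra Y B
  | comm A B => toAlgebra Y A * toAlgebra Y B - toAlgebra Y B * toAlgebra Y A

/-- `□X^a = [X^b, [X_b, X^a]]`, indices lowered with `η`. -/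
def box {D : ℕ} (η : Matrix (Fin D) (Fin D) ℝ) (a : Fin D) : MatrixObs D :=
  sum fun b => sum fun b' => smul (η b b') (comm (X b) (comm (X b') (X a)))

/-- `□X^a □X_a`. -/
def boxBox {D : ℕ} (η : Matrix (Fin D) (Fin D) ℝ) : MatrixObs D :=
  sum fun a => sum fun a' => smul (η a a') (mul (box η a) (box η a'))

/-- `[X^c, [X^a, X^b]] [X_c, [X_a, X_b]]`. -/
def doubleCommSq {D : ℕ} (η : Matrix (Fin D) (Fin D) ℝ) : MatrixObs D :=
  sum fun a => sum fun a' => sum fun b => sum fun b' => sum fun c => sum fun c' =>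
    smul (η a a' * η b b' * η c c')
      (mul (comm (X c) (comm (X a) (X b))) (comm (X c') (comm (X a') (X b'))))

/-- `α □X^a □X_a + (β/2) [X^c, [X^a, X^b]] [X_c, [X_a, X_b]]`, the argument of the trace
in the action `S₆`. -/
def orderSix {D : ℕ} (η : Matrix (Fin D) (Fin D) ℝ) (α β : ℂ) : MatrixObs D :=
  add (smul α (boxBox η)) (smul (β / 2) (doubleCommSq η))

end MatrixObs

theorem MatrixObs.toAlgebra_orderSix {D : ℕ} {𝒜 : Type*} [Ring 𝒜] [Algebra ℂ 𝒜]
    (η : Matrix (Fin D) (Fin D) ℝ) (α β : ℂ) (Y : Fin D → 𝒜) :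
    (orderSix η α β).toAlgebra Y =
      α • ∑ a, ∑ a', (η a a' : ℂ) •
        ((∑ b, ∑ b', (η b b' : ℂ) • ⁅Y b, ⁅Y b', Y a⁆⁆) *
          (∑ b, ∑ b', (η b b' : ℂ) • ⁅Y b, ⁅Y b', Y a'⁆⁆)) +
      (β / 2) • ∑ a, ∑ a', ∑ b, ∑ b', ∑ c, ∑ c', ((η a a' : ℂ) * η b b' * η c c') •
        (⁅Y c, ⁅Y a, Y b⁆⁆ * ⁅Y c', ⁅Y a', Y b'⁆⁆) := by
  simp only [orderSix, boxBox, doubleCommSq, box, toAlgebra, Ring.lie_def]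

/-- The matrix-model action `S₆` on a configuration of `D` matrices of size `N`. -/
def matrixActionSix {D N : ℕ} (η : Matrix (Fin D) (Fin D) ℝ) (α β : ℂ)
    (Y : Fin D → Matrix (Fin N) (Fin N) ℂ) : ℂ :=
  ((MatrixObs.orderSix η α β).toAlgebra Y).trace

/-- Points of the four-dimensional brane in coordinates `x^μ`. -/
abbrev Coord : Type := Fin 4 → ℝ

/-- The partial derivative `∂_μ f`. -/
def pd (μ : Fin 4) (f : Coord → ℂ) (p : Coord) : ℂ :=
  fderiv ℝ f p (Pi.single μ 1)

/-- The bracket `{f, h} = θ^{μν} ∂_μ f ∂_ν h`. -/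
def poissonBracket (θ : Coord → Matrix (Fin 4) (Fin 4) ℂ) (f h : Coord → ℂ) (p : Coord) : ℂ :=
  ∑ μ, ∑ ν, θ p μ ν * pd μ f p * pd ν h p

/-- The semi-classical symbol of an observable: the matrices `X^a` become the functions `x^a`,
commutators become `i` times Poisson brackets, products become pointwise products. -/
def MatrixObs.symbol {D : ℕ} (θ : Coord → Matrix (Fin 4) (Fin 4) ℂ) (x : Fin D → Coord → ℂ) :
    MatrixObs D → Coord → ℂ
  | X a => x a
  | smul c A => fun p => c * symbol θ x A p
  | add A B => fun p => symbol θ x A p + symbol θ x B p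
  | sum A => fun p => ∑ a, symbol θ x (A a) p
  | mul A B => fun p => symbol θ x A p * symbol θ x B p
  | comm A B => fun p => Complex.I * poissonBracket θ (symbol θ x A) (symbol θ x B) p

/-! ### Riemannian geometry in coordinates -/

/-- Christoffel symbols `Γ^l_{mn}` of the Levi-Civita connection of `g`. -/
def christoffel (g : Coord → Matrix (Fin 4) (Fin 4) ℂ) (l m n : Fin 4) (p : Coord) : ℂ :=
  (1 / 2) * ∑ k, (g p)⁻¹ l k *
    (pd m (fun q => g q n k) p + pd n (fun q => g q m k) p - pd k (fun q => g q m n) p)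

/-- `R_{νμλ}{}^κ`, with the sign convention `[∇_ν, ∇_μ] ∂_λ = - R_{νμλ}{}^κ ∂_κ`. -/
def riemannUp (g : Coord → Matrix (Fin 4) (Fin 4) ℂ) (n m l k : Fin 4) (p : Coord) : ℂ :=
  -(pd n (christoffel g k m l) p - pd m (christoffel g k n l) p
    + ∑ e, (christoffel g k n e p * christoffel g e m l p
      - christoffel g k m e p * christoffel g e n l p))

/-- `R_{νμλκ} = R_{νμλ}{}^ε g_{εκ}`. -/
def riemann (g : Coord → Matrix (Fin 4) (Fin 4) ℂ) (n m l k : Fin 4) (p : Coord) : ℂ :=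
  ∑ e, riemannUp g n m l e p * g p e k

/-- `R_{νλ} = R_{νμλ}{}^μ`. -/
def ricci (g : Coord → Matrix (Fin 4) (Fin 4) ℂ) (n l : Fin 4) (p : Coord) : ℂ :=
  ∑ m, riemannUp g n m l m p

/-- `R = g^{νλ} R_{νλ}` (positive on round spheres). -/
def scalarCurv (g : Coord → Matrix (Fin 4) (Fin 4) ℂ) (p : Coord) : ℂ :=
  ∑ n, ∑ l, (g p)⁻¹ n l * ricci g n l p

/-- The Laplace-Beltrami operator `□_g f = g^{μν} (∂_μ ∂_ν f - Γ^λ_{μν} ∂_λ f)`. -/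
def laplaceBeltrami (g : Coord → Matrix (Fin 4) (Fin 4) ℂ) (f : Coord → ℂ) (p : Coord) : ℂ :=
  ∑ m, ∑ n, (g p)⁻¹ m n * (pd m (pd n f) p - ∑ l, christoffel g l m n p * pd l f p)

/-- `∂^μ f ∂_μ f`. -/
def gradSq (g : Coord → Matrix (Fin 4) (Fin 4) ℂ) (f : Coord → ℂ) (p : Coord) : ℂ :=
  ∑ m, ∑ n, (g p)⁻¹ m n * pd m f p * pd n f p

/-! ### The Poisson brane -/

/-- The inverse effective metric `G^{μν} = e^{-σ} θ^{μρ} θ^{νκ} g_{ρκ}`. -/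
def effInvMetric (g θ : Coord → Matrix (Fin 4) (Fin 4) ℂ) (σ : Coord → ℂ) (p : Coord) :
    Matrix (Fin 4) (Fin 4) ℂ :=
  Complex.exp (-σ p) • (θ p * g p * (θ p)ᵀ)

/-- The intrinsic data of a four-dimensional brane on a coordinate domain `U`: the metric
`g_{μν}`, the non-degenerate Poisson tensor `θ^{μν}`, and the quantities `ρ = √(det θ⁻¹)`,
`√(det G)` and `e^{-σ} = ρ / √(det G)`. For Hermitian matrices and Euclidean signature all fields
are real and the square roots are the positive ones. Complex values are admitted because in
Minkowski signature time-like matrices are anti-Hermitian; there `rho` and `sqrtG` are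
smooth branches of the square roots. -/
structure PoissonBrane where
  U : Set Coord
  g : Coord → Matrix (Fin 4) (Fin 4) ℂ
  θ : Coord → Matrix (Fin 4) (Fin 4) ℂ
  σ : Coord → ℂ
  rho : Coord → ℂ
  sqrtG : Coord → ℂ
  isOpen_U : IsOpen U
  g_smooth : ∀ μ ν, ContDiffOn ℝ (⊤ : ℕ∞) (fun p => g p μ ν) U
  θ_smooth : ∀ μ ν, ContDiffOn ℝ (⊤ : ℕ∞) (fun p => θ p μ ν) U
  σ_smooth : ContDiffOn ℝ (⊤ : ℕ∞) σ U
  rho_smooth : ContDiffOn ℝ (⊤ : ℕ∞) rho U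
  sqrtG_smooth : ContDiffOn ℝ (⊤ : ℕ∞) sqrtG U
  g_symm : ∀ p ∈ U, (g p)ᵀ = g p
  g_nondeg : ∀ p ∈ U, (g p).det ≠ 0
  θ_antisymm : ∀ p ∈ U, (θ p)ᵀ = -θ p
  θ_nondeg : ∀ p ∈ U, (θ p).det ≠ 0
  θ_jacobi : ∀ p ∈ U, ∀ l m n : Fin 4,
    ∑ k, (θ p l k * pd k (fun q => θ q m n) p + θ p m k * pd k (fun q => θ q n l) p
      + θ p n k * pd k (fun q => θ q l m) p) = 0
  rho_sq : ∀ p ∈ U, rho p ^ 2 = ((θ p)⁻¹).det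
  sqrtG_sq : ∀ p ∈ U, sqrtG p ^ 2 = ((effInvMetric g θ σ p)⁻¹).det
  exp_neg_σ : ∀ p ∈ U, Complex.exp (-σ p) = rho p / sqrtG p

namespace PoissonBrane

/-- `G_{μν} = g_{μν}`, i.e. `θ⁻¹` is (anti-)self-dual. In that case `sqrtG` is `√g`. -/
def IsSelfDual (M : PoissonBrane) : Prop :=
  ∀ p ∈ M.U, (effInvMetric M.g M.θ M.σ p)⁻¹ = M.g p

/-- `e^σ`. -/
def expσ (M : PoissonBrane) (p : Coord) : ℂ := Complex.exp (M.σ p)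

/-- The intrinsic density
`√g (½ θ^{μρ} θ^{ηα} R_{μρηα} - 2 e^σ R + 2 e^σ ∂^μ σ ∂_μ σ)`. -/
def intrinsicDensity (M : PoissonBrane) (p : Coord) : ℂ :=
  M.sqrtG p *
    ((1 / 2) * (∑ m, ∑ r, ∑ e, ∑ a, M.θ p m r * M.θ p e a * riemann M.g m r e a p)
      - 2 * M.expσ p * scalarCurv M.g p
      + 2 * M.expσ p * gradSq M.g M.σ p)

/-- The vector density `√g g^{μν} ∂_ν e^σ`. -/
def gradExpσ (M : PoissonBrane) (p : Coord) (μ : Fin 4) : ℂ :=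
  M.sqrtG p * ∑ ν, (M.g p)⁻¹ μ ν * pd ν M.expσ p

/-- The functions `x^a`, `a = 1, …, D`, map the brane to flat space with metric `η`, and `g` is
the induced metric `∂_μ x^a ∂_ν x^b η_{ab}`. -/
structure IsEmbedding (M : PoissonBrane) {D : ℕ} (η : Matrix (Fin D) (Fin D) ℝ)
    (x : Fin D → Coord → ℂ) : Prop where
  η_symm : ηᵀ = η
  η_nondeg : η.det ≠ 0
  x_smooth : ∀ a, ContDiffOn ℝ (⊤ : ℕ∞) (x a) M.U
  induced : ∀ p ∈ M.U, ∀ μ ν,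
    M.g p μ ν = ∑ a, ∑ b, (η a b : ℂ) * pd μ (x a) p * pd ν (x b) p

/-- The density `√g e^σ □_g x^a □_g x_a`. -/
def extrinsicDensity (M : PoissonBrane) {D : ℕ} (η : Matrix (Fin D) (Fin D) ℝ)
    (x : Fin D → Coord → ℂ) (p : Coord) : ℂ :=
  M.sqrtG p * M.expσ p *
    ∑ a, ∑ b, (η a b : ℂ) * laplaceBeltrami M.g (x a) p * laplaceBeltrami M.g (x b) p

/-- The integrand `ρ · (symbol of A)` of the semi-classical limit of `Tr A`. -/
def traceDensity (M : PoissonBrane) {D : ℕ} (x : Fin D → Coord → ℂ) (A : MatrixObs D)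
    (p : Coord) : ℂ :=
  M.rho p * A.symbol M.θ x p

/-- The semi-classical limit of `Tr A`: commutators are replaced by `i` times Poisson brackets and
the trace by `(2π)^{-2} ∫ d⁴x ρ`. -/
def semiclassicalTrace (M : PoissonBrane) {D : ℕ} (x : Fin D → Coord → ℂ) (A : MatrixObs D) : ℂ :=
  1 / (2 * (Real.pi : ℂ)) ^ 2 * ∫ p in M.U, M.traceDensity x A p

end PoissonBrane

/-- The vector density `W^μ` on `U` has no flux through the boundary of `U` (or through infinity):
along some sequence of smooth compactly supported cut-offs `0 ≤ χ_k ≤ 1` on `U` with `χ_k → 1`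
pointwise, the flux `-∫ W^μ ∂_μ χ_k` tends to zero. -/
def NoBoundaryFlux (U : Set Coord) (W : Coord → Fin 4 → ℂ) : Prop :=
  ∃ χ : ℕ → Coord → ℝ,
    (∀ k, ContDiff ℝ (⊤ : ℕ∞) (χ k) ∧ HasCompactSupport (χ k) ∧ tsupport (χ k) ⊆ U) ∧
    (∀ k p, 0 ≤ χ k p ∧ χ k p ≤ 1) ∧
    (∀ p ∈ U, Filter.Tendsto (fun k => χ k p) Filter.atTop (nhds 1)) ∧
    Filter.Tendsto (fun k => ∫ p in U, ∑ μ, W p μ * pd μ (fun q => (χ k q : ℂ)) p)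
      Filter.atTop (nhds 0)

end

/-!
Why the reduction holds. The proof is tensor calculus, and almost all of it is algebra: on `U` one
works in the commutative algebra `SmoothFun U` of smooth functions, with the four partial
derivatives as commuting derivations. `SelfDualPoisson` collects the relations of a self-dual brane
in this setting, tensors with two indices being matrices, so that most contractions are matrix
products and traces. Self-duality reads `θ g θ = -e^σ g⁻¹`; up to the factor `-e^{-σ}` the inverse
`ω` of `θ` is `θ` with lowered indices.

*Extrinsic part.* Since the second fundamental form `K = ∇∂x` is normal, the brackets of the
embedding functions satisfy `{x^b, {x_b, f}} = e^σ □ f` (`sum_bracket_bracket`) and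
`{x^c, {x^a, x^b}} {x_c, {x_a, x_b}} = e^σ |∇θ|² + 2 e^{2σ} |K|²` (`sum_bracket_bracket_sq`), while
the Gauss equation gives `|K|² = □x^a □x_a - R` (`normSqK_eq`).

*Intrinsic part.* The Jacobi identity says that `ω` is closed (`nablaω_cyclic`); contracting this
with `θ` shows that it is co-closed too (`sum_h_mul_nablaω`). For such a form `g^{lk} ∇_l ∇_k ω` is
a commutator of covariant derivatives, hence a curvature term. On the other hand
`tr(θ ∇_k ω) = -2 ∂_k σ`, whose divergence relates `θ^{mn} ∇² ω_{mn}` to `|∇θ|²`. Together with the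
first Bianchi identity this is the Weitzenböck identity
`|∇θ|² = θθR - 2 e^σ R + 4 e^σ |∂σ|² - 2 □ e^σ` (`normSqNablaθ_eq`).

Since `ρ e^σ = √g`, the density of the action equals, at each point, the claimed density minus
`β √g □ e^σ`, and the last term is the divergence of `√g ∂^μ e^σ` (`traceDensity_eq`). This gives
the independence of the embedding when `α + β = 0` without any integration. Integrating by parts
against the cut-offs `χ_k` and letting `k → ∞` by dominated convergence, the divergence integrates
to zero (`integral_div_eq_zero_of_noBoundaryFlux`); unless `β = 0`, its integrability follows from
that of the other terms.
-/

noncomputable section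

/-! ### Derivations of matrices over a commutative algebra -/

namespace Derivation

section Matrix

variable {A : Type*} [CommRing A] [Algebra ℂ A] {l m n : Type*} (D : Derivation ℂ A A)

/-- The entrywise action of a derivation on matrices. -/
def mat (M : Matrix m n A) : Matrix m n A := M.map D

@[simp] lemma mat_apply (M : Matrix m n A) (i : m) (j : n) : D.mat M i j = D (M i j) := rfl

lemma mat_mul [Fintype m] (M : Matrix l m A) (N : Matrix m n A) :
    D.mat (M * N) = D.mat M * N + M * D.mat N := by
  ext i j
  simp only [mat_apply, Matrix.mul_apply, Matrix.add_apply, map_sum, leibniz, smul_eq_mul,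
    ← Finset.sum_add_distrib]
  exact Finset.sum_congr rfl fun k _ => by ring

lemma mat_transpose (M : Matrix m n A) : D.mat Mᵀ = (D.mat M)ᵀ := rfl

lemma mat_neg (M : Matrix m n A) : D.mat (-M) = -D.mat M := by
  ext i j; simp

lemma mat_sub (M N : Matrix m n A) : D.mat (M - N) = D.mat M - D.mat N := by
  ext i j; simp

lemma mat_smul (a : A) (M : Matrix m n A) : D.mat (a • M) = D a • M + a • D.mat M := by
  ext i j
  simp only [mat_apply, Matrix.smul_apply, Matrix.add_apply, smul_eq_mul, leibniz]
  ring

lemma mat_one [DecidableEq m] : D.mat (1 : Matrix m m A) = 0 := by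
  ext i j
  by_cases h : i = j
  · subst h; simp
  · simp [Matrix.one_apply_ne h]

lemma trace_mat [Fintype m] (M : Matrix m m A) : D M.trace = (D.mat M).trace := by
  simp [Matrix.trace]

/-- Jacobi's formula for the derivative of a determinant. -/
lemma det_eq_trace_adjugate [Fintype m] [DecidableEq m] (M : Matrix m m A) :
    D M.det = (M.adjugate * D.mat M).trace := by
  have hcol : ∀ i, (M.updateCol i fun j => D (M j i)).det
      = ∑ j, M.adjugate i j * D (M j i) := by
    intro i
    rw [← Matrix.cramer_apply, Matrix.cramer_eq_adjugate_mulVec]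
    rfl
  have hprod : ∀ s : Equiv.Perm m, D (∏ i, M (s i) i)
      = ∑ i, ∏ j, (M.updateCol i fun j => D (M j i)) (s j) j := by
    intro s
    have key : ∀ t : Finset m, D (∏ i ∈ t, M (s i) i)
        = ∑ i ∈ t, ∏ j ∈ t, (M.updateCol i fun j => D (M j i)) (s j) j := by
      intro t
      induction t using Finset.induction_on with
      | empty => simp
      | insert a t ha ih =>
        rw [Finset.prod_insert ha, leibniz, ih, Finset.sum_insert ha, Finset.prod_insert ha]
        have h1 : ∏ j ∈ t, (M.updateCol a fun j => D (M j a)) (s j) j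
            = ∏ j ∈ t, M (s j) j :=
          Finset.prod_congr rfl fun j hj => by
            rw [Matrix.updateCol_ne]; rintro rfl; exact ha hj
        have h2 : ∀ i ∈ t, ∏ j ∈ insert a t, (M.updateCol i fun j => D (M j i)) (s j) j
            = M (s a) a * ∏ j ∈ t, (M.updateCol i fun j => D (M j i)) (s j) j := by
          intro i hi
          rw [Finset.prod_insert ha, Matrix.updateCol_ne]
          rintro rfl; exact ha hi
        rw [Finset.sum_congr rfl h2, h1, Matrix.updateCol_self]
        simp only [smul_eq_mul, Finset.mul_sum]
        ring
    exact key Finset.univ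
  simp only [Matrix.trace, Matrix.diag_apply, Matrix.mul_apply, mat_apply, ← hcol]
  simp only [Matrix.det_apply, map_sum, Units.smul_def, map_zsmul, hprod, Finset.smul_sum]
  rw [Finset.sum_comm]

end Matrix

end Derivation

/-! ### Self-dual Poisson structures over a differential algebra -/

/-- The algebraic model of a self-dual brane. The functions form a commutative algebra `A` with
four commuting derivations `d`; `h` is the inverse of the metric `g`, `ω` is the inverse of
the Poisson tensor `θ`, and `E`, `E'` stand for `e^σ`, `e^{-σ}`. Self-duality `G = g` reads
`θ g θ = -e^σ g⁻¹`. -/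
structure SelfDualPoisson (A : Type*) [CommRing A] [Algebra ℂ A] where
  d : Fin 4 → Derivation ℂ A A
  g : Matrix (Fin 4) (Fin 4) A
  h : Matrix (Fin 4) (Fin 4) A
  θ : Matrix (Fin 4) (Fin 4) A
  ω : Matrix (Fin 4) (Fin 4) A
  σ : A
  E : A
  E' : A
  d_comm : ∀ i j a, d i (d j a) = d j (d i a)
  g_symm : gᵀ = g
  θ_antisymm : θᵀ = -θ
  g_mul_h : g * h = 1
  θ_mul_ω : θ * ω = 1
  E_mul_E' : E * E' = 1
  d_E : ∀ k, d k E = E * d k σ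
  selfDual : θ * g * θ = -(E • h)
  jacobi : ∀ l m n, ∑ k, (θ l k * d k (θ m n) + θ m k * d k (θ n l) + θ n k * d k (θ l m)) = 0

namespace SelfDualPoisson

variable {A : Type*} [CommRing A] [Algebra ℂ A] (B : SelfDualPoisson A)

lemma h_mul_g : B.h * B.g = 1 := mul_eq_one_comm.mp B.g_mul_h

lemma ω_mul_θ : B.ω * B.θ = 1 := mul_eq_one_comm.mp B.θ_mul_ω

lemma h_symm : B.hᵀ = B.h := by
  have h1 : B.hᵀ * B.g = 1 := by
    rw [← B.g_symm, ← Matrix.transpose_mul, B.g_mul_h, Matrix.transpose_one]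
  calc B.hᵀ = B.hᵀ * (B.g * B.h) := by rw [B.g_mul_h, mul_one]
    _ = B.h := by rw [← mul_assoc, h1, one_mul]

lemma ω_antisymm : B.ωᵀ = -B.ω := by
  have h1 : B.ωᵀ * B.θ = -1 := by
    have := congrArg Matrix.transpose B.θ_mul_ω
    rw [Matrix.transpose_mul, B.θ_antisymm, Matrix.transpose_one] at this
    rw [← this, mul_neg, neg_neg]
  calc B.ωᵀ = B.ωᵀ * (B.θ * B.ω) := by rw [B.θ_mul_ω, mul_one]
    _ = -B.ω := by rw [← mul_assoc, h1, neg_mul, one_mul]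

/-- `E ω = -g θ g`: up to the conformal factor, `ω` is `θ` with its indices lowered. -/
lemma E_smul_ω : B.E • B.ω = -(B.g * B.θ * B.g) := by
  have h1 : B.g * (B.θ * B.g * B.θ) * B.ω = -(B.E • B.ω) := by
    rw [B.selfDual, mul_neg, neg_mul, Matrix.mul_smul, B.g_mul_h, Matrix.smul_mul, one_mul]
  rw [← neg_eq_iff_eq_neg, ← h1]
  simp only [mul_assoc, B.θ_mul_ω, mul_one]

lemma ω_eq : B.ω = -(B.E' • (B.g * B.θ * B.g)) := by
  rw [← smul_neg, ← B.E_smul_ω, smul_smul, mul_comm, B.E_mul_E', one_smul]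

/-- The Levi-Civita connection of `g` as a family of matrices, `(Γ_k)^i_j = Γ^i_{kj}`. -/
def Γ (k : Fin 4) : Matrix (Fin 4) (Fin 4) A := Matrix.of fun i j =>
  algebraMap ℂ A (1 / 2) *
    ∑ l, B.h i l * (B.d k (B.g j l) + B.d j (B.g k l) - B.d l (B.g k j))

lemma two_mul_half : (2 : A) * algebraMap ℂ A (1 / 2) = 1 := by
  have : (2 : A) = algebraMap ℂ A 2 := (map_ofNat _ 2).symm
  rw [this, ← map_mul]; norm_num

lemma g_apply_comm (i j : Fin 4) : B.g i j = B.g j i := congrFun (congrFun B.g_symm j) i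

lemma h_apply_comm (i j : Fin 4) : B.h i j = B.h j i := congrFun (congrFun B.h_symm j) i

lemma θ_apply_neg (i j : Fin 4) : B.θ j i = -B.θ i j := congrFun (congrFun B.θ_antisymm i) j

lemma ω_apply_neg (i j : Fin 4) : B.ω j i = -B.ω i j := congrFun (congrFun B.ω_antisymm i) j

/-- The connection is torsion free. -/
lemma Γ_symm (i j k : Fin 4) : B.Γ k i j = B.Γ j i k := by
  simp only [Γ, Matrix.of_apply]
  congr 1
  refine Finset.sum_congr rfl fun l _ => ?_
  rw [B.g_apply_comm j k]
  ring

lemma g_mul_Γ (k a b : Fin 4) : (B.g * B.Γ k) a b = algebraMap ℂ A (1 / 2) *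
    (B.d k (B.g b a) + B.d b (B.g k a) - B.d a (B.g k b)) := by
  have h1 : B.Γ k = algebraMap ℂ A (1 / 2) • (B.h * Matrix.of fun l j =>
      B.d k (B.g j l) + B.d j (B.g k l) - B.d l (B.g k j)) := by
    ext i j
    simp [Γ, Matrix.mul_apply]
  rw [h1, Matrix.mul_smul, ← mul_assoc, B.g_mul_h, one_mul]
  rfl

/-- The connection is metric. -/
lemma mat_g (k : Fin 4) : (B.d k).mat B.g = B.g * B.Γ k + (B.Γ k)ᵀ * B.g := by
  ext a b
  have h1 : ((B.Γ k)ᵀ * B.g) a b = (B.g * B.Γ k) b a := by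
    rw [← Matrix.transpose_apply (B.g * B.Γ k), Matrix.transpose_mul, B.g_symm]
  rw [Matrix.add_apply, h1, g_mul_Γ, g_mul_Γ, Derivation.mat_apply, B.g_apply_comm b a]
  linear_combination -(B.d k (B.g a b)) * two_mul_half (A := A)

lemma mat_h (k : Fin 4) : (B.d k).mat B.h = -(B.Γ k * B.h) - B.h * (B.Γ k)ᵀ := by
  have h1 := congrArg (B.d k).mat B.g_mul_h
  rw [Derivation.mat_mul, Derivation.mat_one, mat_g] at h1
  have h2 := congrArg (B.h * ·) h1
  simp only [mul_zero, mul_add, add_mul] at h2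
  have e1 : B.h * (B.g * B.Γ k * B.h) = B.Γ k * B.h := by
    rw [← mul_assoc, ← mul_assoc, B.h_mul_g, one_mul]
  have e2 : B.h * ((B.Γ k)ᵀ * B.g * B.h) = B.h * (B.Γ k)ᵀ := by
    rw [mul_assoc, B.g_mul_h, mul_one]
  have e3 : B.h * (B.g * (B.d k).mat B.h) = (B.d k).mat B.h := by
    rw [← mul_assoc, B.h_mul_g, one_mul]
  rw [e1, e2, e3] at h2
  rw [← sub_eq_zero, ← h2]
  abel

/-! ### Covariant derivatives of the Poisson tensor and of its inverse -/

/-- The covariant derivative `∇_k θ^{mn}`. -/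
def nablaθ (k : Fin 4) : Matrix (Fin 4) (Fin 4) A :=
  (B.d k).mat B.θ + B.Γ k * B.θ + B.θ * (B.Γ k)ᵀ

/-- The covariant derivative `∇_k ω_{mn}`. -/
def nablaω (k : Fin 4) : Matrix (Fin 4) (Fin 4) A :=
  (B.d k).mat B.ω - (B.Γ k)ᵀ * B.ω - B.ω * B.Γ k

lemma nablaθ_antisymm (k : Fin 4) : (B.nablaθ k)ᵀ = -B.nablaθ k := by
  simp only [nablaθ, Matrix.transpose_add, Matrix.transpose_mul, Matrix.transpose_transpose,
    ← Derivation.mat_transpose, B.θ_antisymm, Derivation.mat_neg, mul_neg, neg_mul]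
  abel

lemma nablaω_antisymm (k : Fin 4) : (B.nablaω k)ᵀ = -B.nablaω k := by
  simp only [nablaω, Matrix.transpose_sub, Matrix.transpose_mul, Matrix.transpose_transpose,
    ← Derivation.mat_transpose, B.ω_antisymm, Derivation.mat_neg, mul_neg, neg_mul]
  abel

/-- The covariant derivative of the self-duality relation. -/
lemma nablaθ_anticomm (k : Fin 4) :
    B.nablaθ k * B.g * B.θ + B.θ * B.g * B.nablaθ k = -((B.E * B.d k B.σ) • B.h) := by
  have h1 := congrArg (B.d k).mat B.selfDual
  rw [Derivation.mat_mul, Derivation.mat_mul, Derivation.mat_neg, Derivation.mat_smul, mat_h,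
    mat_g, B.d_E] at h1
  have h2 : B.E • B.h = -(B.θ * B.g * B.θ) := by rw [B.selfDual, neg_neg]
  have h3 : B.E • (-(B.Γ k * B.h) - B.h * (B.Γ k)ᵀ)
      = B.Γ k * (B.θ * B.g * B.θ) + (B.θ * B.g * B.θ) * (B.Γ k)ᵀ := by
    rw [smul_sub, smul_neg, ← Matrix.mul_smul, ← Matrix.smul_mul, h2]
    noncomm_ring
  rw [h3] at h1
  have h4 : B.nablaθ k * B.g * B.θ + B.θ * B.g * B.nablaθ k
      = ((B.d k).mat B.θ * B.g + B.θ * (B.g * B.Γ k + (B.Γ k)ᵀ * B.g)) * B.θ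
        + B.θ * B.g * (B.d k).mat B.θ
        + (B.Γ k * (B.θ * B.g * B.θ) + (B.θ * B.g * B.θ) * (B.Γ k)ᵀ) := by
    simp only [nablaθ]; noncomm_ring
  rw [h4, h1]
  abel

lemma nablaω_eq (k : Fin 4) : B.nablaω k = -(B.ω * B.nablaθ k * B.ω) := by
  have h1 := congrArg (B.d k).mat B.ω_mul_θ
  rw [Derivation.mat_mul, Derivation.mat_one] at h1
  have h2 : (B.d k).mat B.ω = -(B.ω * (B.d k).mat B.θ * B.ω) := by
    have h3 := congrArg (· * B.ω) h1
    simp only [add_mul, zero_mul] at h3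
    rw [mul_assoc ((B.d k).mat B.ω), B.θ_mul_ω, mul_one] at h3
    exact eq_neg_of_add_eq_zero_left h3
  have h4 : B.ω * B.nablaθ k * B.ω = B.ω * (B.d k).mat B.θ * B.ω
      + B.ω * B.Γ k * (B.θ * B.ω) + (B.ω * B.θ) * (B.Γ k)ᵀ * B.ω := by
    simp only [nablaθ]; noncomm_ring
  rw [h4, B.θ_mul_ω, B.ω_mul_θ, nablaω, h2]
  noncomm_ring

lemma trace_nablaθ_mul_ω (k : Fin 4) : (B.nablaθ k * B.ω).trace = 2 * B.d k B.σ := by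
  have h1 := congrArg (fun M => (M * B.g).trace) (B.nablaθ_anticomm k)
  have h2 : (B.θ * B.g * B.nablaθ k * B.g).trace = (B.nablaθ k * B.g * B.θ * B.g).trace := by
    rw [mul_assoc, Matrix.trace_mul_comm]
    congr 1; noncomm_ring
  have h3 : (B.nablaθ k * B.ω).trace
      = -(B.E' * (B.nablaθ k * B.g * B.θ * B.g).trace) := by
    rw [ω_eq, mul_neg, Matrix.trace_neg, Matrix.mul_smul, Matrix.trace_smul, smul_eq_mul]
    congr 3; noncomm_ring
  simp only [add_mul, Matrix.trace_add, h2, neg_mul, Matrix.smul_mul, B.h_mul_g,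
    Matrix.trace_neg, Matrix.trace_smul, Matrix.trace_one, Fintype.card_fin, smul_eq_mul,
    Nat.cast_ofNat] at h1
  have h4 : (B.nablaθ k * B.g * B.θ * B.g).trace = -(2 * (B.E * B.d k B.σ)) := by
    linear_combination algebraMap ℂ A (1 / 2) * h1
      - ((B.nablaθ k * B.g * B.θ * B.g).trace + 2 * (B.E * B.d k B.σ)) * two_mul_half (A := A)
  rw [h3, h4]
  linear_combination 2 * B.d k B.σ * B.E_mul_E'

/-! ### Closedness and co-closedness of the symplectic form -/

lemma eq_zero_of_forall_sum_θ_mul {u : Fin 4 → A} (hu : ∀ l, ∑ k, B.θ l k * u k = 0) (k : Fin 4) :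
    u k = 0 := by
  have h1 : B.θ *ᵥ u = 0 := funext hu
  have h2 : u = B.ω *ᵥ (B.θ *ᵥ u) := by
    rw [Matrix.mulVec_mulVec, B.ω_mul_θ, Matrix.one_mulVec]
  rw [h2, h1, Matrix.mulVec_zero, Pi.zero_apply]

lemma d_θ_apply (k m n : Fin 4) :
    B.d k (B.θ m n) = ∑ a, ∑ b, B.θ m a * B.θ n b * B.d k (B.ω a b) := by
  have h1 := congrArg (B.d k).mat B.θ_mul_ω
  rw [Derivation.mat_mul, Derivation.mat_one] at h1
  have h2 := congrArg (· * B.θ) h1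
  simp only [add_mul, zero_mul] at h2
  rw [mul_assoc ((B.d k).mat B.θ), B.ω_mul_θ, mul_one] at h2
  have h3 := Matrix.ext_iff.mpr (eq_neg_of_add_eq_zero_left h2) m n
  rw [Derivation.mat_apply] at h3
  rw [h3, Matrix.neg_apply, Matrix.mul_apply]
  simp only [Matrix.mul_apply, Finset.sum_mul, ← Finset.sum_neg_distrib]
  rw [Finset.sum_comm]
  refine Finset.sum_congr rfl fun a _ => Finset.sum_congr rfl fun b _ => ?_
  rw [B.θ_apply_neg n b, Derivation.mat_apply]
  ring

/-- The Jacobi identity for `θ` says that its inverse is a closed two-form. -/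
lemma d_ω_cyclic (k m n : Fin 4) :
    B.d k (B.ω m n) + B.d m (B.ω n k) + B.d n (B.ω k m) = 0 := by
  have key : ∀ l r s, ∑ k, B.θ l k * ∑ m, B.θ r m * ∑ n, B.θ s n *
      (B.d k (B.ω m n) + B.d m (B.ω n k) + B.d n (B.ω k m)) = 0 := by
    intro l r s
    rw [← B.jacobi l r s]
    simp only [d_θ_apply, Finset.mul_sum, Finset.sum_add_distrib, mul_add]
    congr 1
    · congr 1
      · refine Finset.sum_congr rfl fun k _ => Finset.sum_congr rfl fun m _ =>
          Finset.sum_congr rfl fun n _ => by ring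
      · rw [Finset.sum_comm]
        refine Finset.sum_congr rfl fun m _ => ?_
        rw [Finset.sum_comm]
        refine Finset.sum_congr rfl fun n _ => Finset.sum_congr rfl fun k _ => by ring
    · rw [Finset.sum_congr rfl fun k _ => Finset.sum_comm, Finset.sum_comm]
      refine Finset.sum_congr rfl fun n _ => Finset.sum_congr rfl fun k _ =>
        Finset.sum_congr rfl fun m _ => by ring
  exact B.eq_zero_of_forall_sum_θ_mul (fun s => B.eq_zero_of_forall_sum_θ_mul (fun r =>
    B.eq_zero_of_forall_sum_θ_mul (fun l => key l r s) k) m) n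

lemma nablaω_apply (k m n : Fin 4) : B.nablaω k m n
    = B.d k (B.ω m n) - ∑ j, (B.Γ k j m * B.ω j n + B.ω m j * B.Γ k j n) := by
  simp only [nablaω, Matrix.sub_apply, Matrix.mul_apply, Matrix.transpose_apply,
    Derivation.mat_apply, Finset.sum_add_distrib]
  ring

/-- The exterior derivative may be computed with the torsion-free connection. -/
lemma nablaω_cyclic (k m n : Fin 4) :
    B.nablaω k m n + B.nablaω m n k + B.nablaω n k m = 0 := by
  have h1 : ∑ j, (B.Γ k j m * B.ω j n + B.ω m j * B.Γ k j n)
      + ∑ j, (B.Γ m j n * B.ω j k + B.ω n j * B.Γ m j k)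
      + ∑ j, (B.Γ n j k * B.ω j m + B.ω k j * B.Γ n j m) = 0 := by
    rw [← Finset.sum_add_distrib, ← Finset.sum_add_distrib]
    refine Finset.sum_eq_zero fun j _ => ?_
    rw [B.Γ_symm j m k, B.Γ_symm j n k, B.Γ_symm j n m, B.ω_apply_neg m j, B.ω_apply_neg n j,
      B.ω_apply_neg k j]
    ring
  simp only [nablaω_apply]
  linear_combination B.d_ω_cyclic k m n - h1

lemma nablaω_apply_neg (k m n : Fin 4) : B.nablaω k n m = -B.nablaω k m n :=
  congrFun (congrFun (B.nablaω_antisymm k) m) n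

lemma trace_θ_mul_nablaω (k : Fin 4) : (B.θ * B.nablaω k).trace = -(2 * B.d k B.σ) := by
  rw [nablaω_eq, mul_neg, Matrix.trace_neg, ← trace_nablaθ_mul_ω]
  congr 2
  rw [← mul_assoc, ← mul_assoc, B.θ_mul_ω, one_mul]

/-- Contracting `∇_{[k} ω_{mn]} = 0` with `θ` gives the divergence of `θ`. -/
lemma sum_nablaθ_mul_ω (n : Fin 4) : ∑ k, (B.nablaθ k * B.ω) k n = B.d n B.σ := by
  have h1 : ∑ k, ∑ m, B.θ k m * B.nablaω k m n = -∑ k, (B.nablaθ k * B.ω) k n := by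
    rw [← Finset.sum_neg_distrib]
    refine Finset.sum_congr rfl fun k _ => ?_
    rw [← Matrix.mul_apply, nablaω_eq, mul_neg, Matrix.neg_apply, ← mul_assoc, ← mul_assoc,
      B.θ_mul_ω, one_mul]
  have h2 : ∑ k, ∑ m, B.θ k m * B.nablaω m n k = ∑ k, ∑ m, B.θ k m * B.nablaω k m n := by
    rw [Finset.sum_comm]
    refine Finset.sum_congr rfl fun k _ => Finset.sum_congr rfl fun m _ => ?_
    rw [B.θ_apply_neg k m, B.nablaω_apply_neg k m n, neg_mul_neg]
  have h3 : ∑ k, ∑ m, B.θ k m * B.nablaω n k m = 2 * B.d n B.σ := by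
    rw [← neg_neg (2 * B.d n B.σ), ← trace_θ_mul_nablaω, ← Matrix.trace_neg, ← mul_neg,
      ← nablaω_antisymm]
    rfl
  have h4 : ∑ k, ∑ m, B.θ k m * B.nablaω k m n + ∑ k, ∑ m, B.θ k m * B.nablaω m n k
      + ∑ k, ∑ m, B.θ k m * B.nablaω n k m = 0 := by
    simp only [← Finset.sum_add_distrib, ← mul_add, nablaω_cyclic, mul_zero,
      Finset.sum_const_zero]
  rw [h2, h3, h1] at h4
  linear_combination (-algebraMap ℂ A (1 / 2)) * h4
    - (∑ k, (B.nablaθ k * B.ω) k n - B.d n B.σ) * two_mul_half (A := A)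

/-- `∇_k θ^{kn} = ∂_k σ θ^{kn}`, that is `∇_k (e^{-σ} θ^{kn}) = 0`. -/
lemma sum_nablaθ (n : Fin 4) : ∑ k, B.nablaθ k k n = ∑ k, B.d k B.σ * B.θ k n := by
  have h1 : ∀ k, B.nablaθ k k n = ∑ m, (B.nablaθ k * B.ω) k m * B.θ m n := by
    intro k
    rw [← Matrix.mul_apply, mul_assoc, B.ω_mul_θ, mul_one]
  simp only [h1]
  rw [Finset.sum_comm]
  simp only [← Finset.sum_mul, sum_nablaθ_mul_ω]

/-- Divergence of `θ g ∇θ`: the first-order terms of `{x^b, {x_b, f}}` cancel. -/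
lemma sum_θ_g_nablaθ (k : Fin 4) : ∑ n, (B.θ * B.g * B.nablaθ n) n k = 0 := by
  have h1 : ∀ n, B.θ * B.g * B.nablaθ n
      = -((B.E * B.d n B.σ) • B.h) - B.nablaθ n * (B.g * B.θ) := by
    intro n
    rw [← nablaθ_anticomm, mul_assoc (B.nablaθ n)]; abel
  have h2 : ∑ n, (B.nablaθ n * (B.g * B.θ)) n k = -∑ n, B.E * B.d n B.σ * B.h n k := by
    have h3 : ∀ n, (B.nablaθ n * (B.g * B.θ)) n k
        = ∑ m, B.nablaθ n n m * (B.g * B.θ) m k := fun n => Matrix.mul_apply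
    simp only [h3]
    rw [Finset.sum_comm]
    simp only [← Finset.sum_mul, sum_nablaθ]
    simp only [Finset.sum_mul]
    rw [Finset.sum_comm, ← Finset.sum_neg_distrib]
    refine Finset.sum_congr rfl fun n _ => ?_
    have h3 := Matrix.ext_iff.mpr B.selfDual n k
    rw [mul_assoc, Matrix.mul_apply, Matrix.neg_apply, Matrix.smul_apply, smul_eq_mul] at h3
    simp only [mul_assoc]
    rw [← Finset.mul_sum, h3]
    ring
  simp only [h1, Matrix.sub_apply, Matrix.neg_apply, Matrix.smul_apply, smul_eq_mul,
    Finset.sum_sub_distrib, h2, Finset.sum_neg_distrib]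
  ring

lemma h_mul_ω : B.h * B.ω = -(B.E' • (B.θ * B.g)) := by
  rw [ω_eq, mul_neg, Matrix.mul_smul, ← mul_assoc, ← mul_assoc, B.h_mul_g, one_mul]

lemma h_mul_nablaω (k : Fin 4) :
    B.h * B.nablaω k = -(B.d k B.σ • (B.h * B.ω)) - B.E' • (B.nablaθ k * B.g) := by
  have h1 : B.θ * B.g * B.nablaθ k = -((B.E * B.d k B.σ) • B.h) - B.nablaθ k * B.g * B.θ := by
    rw [← nablaθ_anticomm]; abel
  have h2 : B.E' * (B.E * B.d k B.σ) = B.d k B.σ := by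
    linear_combination B.d k B.σ * B.E_mul_E'
  calc B.h * B.nablaω k = -((B.h * B.ω) * B.nablaθ k * B.ω) := by
        rw [nablaω_eq, mul_neg]; simp only [mul_assoc]
    _ = B.E' • ((B.θ * B.g * B.nablaθ k) * B.ω) := by
        rw [h_mul_ω, neg_mul, neg_mul, neg_neg, Matrix.smul_mul, Matrix.smul_mul]
    _ = _ := by
        rw [h1, sub_mul, neg_mul, Matrix.smul_mul, mul_assoc _ B.θ, B.θ_mul_ω, mul_one, smul_sub,
          smul_neg, smul_smul, h2]

/-- `ω` is co-closed. -/
lemma sum_h_mul_nablaω (n : Fin 4) : ∑ k, ∑ m, B.h k m * B.nablaω k m n = 0 := by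
  simp only [← Matrix.mul_apply, h_mul_nablaω, h_mul_ω, Matrix.sub_apply, Matrix.neg_apply,
    Matrix.smul_apply, smul_eq_mul, Finset.sum_sub_distrib, Finset.sum_neg_distrib]
  have h1 : ∑ k, B.E' * (B.nablaθ k * B.g) k n
      = ∑ k, B.d k B.σ * (B.E' * (B.θ * B.g) k n) := by
    have h2 : ∑ k, (B.nablaθ k * B.g) k n = ∑ k, B.d k B.σ * (B.θ * B.g) k n := by
      simp only [Matrix.mul_apply, Finset.mul_sum]
      rw [Finset.sum_comm]
      simp only [← Finset.sum_mul, sum_nablaθ]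
      rw [Finset.sum_comm]
      simp only [Finset.sum_mul, mul_assoc]
    rw [← Finset.mul_sum, h2, Finset.mul_sum]
    exact Finset.sum_congr rfl fun k _ => by ring
  rw [h1]
  simp

/-! ### Second covariant derivatives and curvature -/

/-- The curvature matrices `∂_k Γ_l - ∂_l Γ_k + [Γ_k, Γ_l]`. -/
def curv (k l : Fin 4) : Matrix (Fin 4) (Fin 4) A :=
  (B.d k).mat (B.Γ l) - (B.d l).mat (B.Γ k) + B.Γ k * B.Γ l - B.Γ l * B.Γ k

/-- The second covariant derivative `∇_l ∇_k ω_{mn}`. -/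
def nabla2ω (l k : Fin 4) : Matrix (Fin 4) (Fin 4) A :=
  (B.d l).mat (B.nablaω k) - (B.Γ l)ᵀ * B.nablaω k - B.nablaω k * B.Γ l
    - ∑ j, B.Γ l j k • B.nablaω j

lemma nabla2ω_apply (l k m n : Fin 4) : B.nabla2ω l k m n = B.d l (B.nablaω k m n)
    - ∑ j, (B.Γ l j m * B.nablaω k j n + B.nablaω k m j * B.Γ l j n
      + B.Γ l j k * B.nablaω j m n) := by
  simp only [nabla2ω, Matrix.sub_apply, Matrix.mul_apply, Matrix.transpose_apply,
    Derivation.mat_apply, Finset.sum_add_distrib, Matrix.sum_apply, Matrix.smul_apply, smul_eq_mul]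
  ring

lemma nabla2ω_apply_neg (l k m n : Fin 4) : B.nabla2ω l k n m = -B.nabla2ω l k m n := by
  rw [nabla2ω_apply, nabla2ω_apply, B.nablaω_apply_neg k m n, map_neg, neg_sub', sub_neg_eq_add,
    sub_eq_add_neg, ← Finset.sum_neg_distrib]
  congr 1
  refine Finset.sum_congr rfl fun j _ => ?_
  rw [B.nablaω_apply_neg k m j, B.nablaω_apply_neg j m n, B.nablaω_apply_neg k n j]
  ring

lemma nabla2ω_cyclic (l k m n : Fin 4) :
    B.nabla2ω l k m n + B.nabla2ω l m n k + B.nabla2ω l n k m = 0 := by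
  have h0 : B.d l (B.nablaω k m n) + B.d l (B.nablaω m n k) + B.d l (B.nablaω n k m) = 0 := by
    rw [← map_add, ← map_add, nablaω_cyclic, map_zero]
  simp only [nabla2ω_apply]
  rw [sub_add_sub_comm, sub_add_sub_comm, h0, ← Finset.sum_add_distrib, ← Finset.sum_add_distrib,
    zero_sub, neg_eq_zero]
  refine Finset.sum_eq_zero fun j _ => ?_
  linear_combination B.Γ l j k * B.nablaω_cyclic j m n + B.Γ l j m * B.nablaω_cyclic k j n
    + B.Γ l j n * B.nablaω_cyclic k m j

/-- The Ricci identity for `ω`. -/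
lemma nabla2ω_sub (l k : Fin 4) : B.nabla2ω l k - B.nabla2ω k l
    = -((B.curv l k)ᵀ * B.ω + B.ω * B.curv l k) := by
  have h1 : ∑ j, B.Γ l j k • B.nablaω j = ∑ j, B.Γ k j l • B.nablaω j :=
    Finset.sum_congr rfl fun j _ => by rw [B.Γ_symm j k l]
  have h2 : (B.d l).mat ((B.d k).mat B.ω) = (B.d k).mat ((B.d l).mat B.ω) := by
    ext i j; exact B.d_comm l k _
  simp only [nabla2ω, h1]
  simp only [nablaω, curv, Derivation.mat_sub, Derivation.mat_mul,
    Derivation.mat_transpose, Matrix.transpose_sub, Matrix.transpose_add, Matrix.transpose_mul, h2]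
  noncomm_ring

lemma d_h_apply (l k m : Fin 4) :
    B.d l (B.h k m) = -∑ j, (B.Γ l k j * B.h j m + B.h k j * B.Γ l m j) := by
  have h1 := Matrix.ext_iff.mpr (B.mat_h l) k m
  simp only [Derivation.mat_apply, Matrix.sub_apply, Matrix.neg_apply, Matrix.mul_apply,
    Matrix.transpose_apply] at h1
  rw [h1, Finset.sum_add_distrib]
  ring

lemma sum_h_mul_nabla2ω (l n : Fin 4) : ∑ k, ∑ m, B.h k m * B.nabla2ω l k m n = 0 := by
  have h0 := congrArg (B.d l) (B.sum_h_mul_nablaω n)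
  simp only [map_sum, Derivation.leibniz, smul_eq_mul, map_zero, Finset.sum_add_distrib,
    d_h_apply] at h0
  simp only [nabla2ω_apply, mul_sub, Finset.sum_sub_distrib, Finset.mul_sum, mul_add,
    Finset.sum_add_distrib]
  simp only [mul_add, mul_neg, Finset.mul_sum, Finset.sum_add_distrib, Finset.sum_neg_distrib] at h0
  have e1 : ∑ k, ∑ m, ∑ j, B.nablaω k m n * (B.Γ l k j * B.h j m)
      = ∑ k, ∑ m, ∑ j, B.h k m * (B.Γ l j k * B.nablaω j m n) := by
    rw [Finset.sum_congr rfl fun k _ => Finset.sum_comm, Finset.sum_comm,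
      Finset.sum_congr rfl fun k _ => Finset.sum_comm]
    exact Finset.sum_congr rfl fun k _ => Finset.sum_congr rfl fun m _ =>
      Finset.sum_congr rfl fun j _ => by ring
  have e2 : ∑ k, ∑ m, ∑ j, B.nablaω k m n * (B.h k j * B.Γ l m j)
      = ∑ k, ∑ m, ∑ j, B.h k m * (B.Γ l j m * B.nablaω k j n) := by
    refine Finset.sum_congr rfl fun k _ => ?_
    rw [Finset.sum_comm]
    exact Finset.sum_congr rfl fun m _ => Finset.sum_congr rfl fun j _ => by ring
  have e3 : ∑ k, ∑ m, ∑ j, B.h k m * (B.nablaω k m j * B.Γ l j n) = 0 := by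
    rw [Finset.sum_congr rfl fun k _ => Finset.sum_comm, Finset.sum_comm]
    refine Finset.sum_eq_zero fun j _ => ?_
    simp only [← mul_assoc, ← Finset.sum_mul, sum_h_mul_nablaω, zero_mul]
  rw [e1, e2] at h0
  rw [e3]
  linear_combination h0

/-- The components `R_{nml}{}^k`. -/
def riemannUp (n m l k : Fin 4) : A := -B.curv n m k l

/-- The components `R_{nmlk}`. -/
def riemann (n m l k : Fin 4) : A := ∑ e, B.riemannUp n m l e * B.g e k

/-- The scalar curvature. -/
def scalarCurv : A := ∑ n, ∑ l, B.h n l * ∑ m, B.riemannUp n m l m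

lemma curv_neg (k l : Fin 4) : B.curv l k = -B.curv k l := by
  simp only [curv]; abel

/-- The first Bianchi identity. -/
lemma curv_cyclic (j l m n : Fin 4) : B.curv l m j n + B.curv m n j l + B.curv n l j m = 0 := by
  simp only [curv, Matrix.sub_apply, Matrix.add_apply, Derivation.mat_apply, Matrix.mul_apply,
    B.Γ_symm _ n m, B.Γ_symm _ n l, B.Γ_symm _ m l]
  ring

lemma riemann_cyclic (l m n p : Fin 4) :
    B.riemann l m n p + B.riemann m n l p + B.riemann n l m p = 0 := by
  simp only [riemann, riemannUp, ← Finset.sum_add_distrib]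
  exact Finset.sum_eq_zero fun e _ => by linear_combination (-B.g e p) * B.curv_cyclic e l m n

lemma riemann_neg (l m n p : Fin 4) : B.riemann m l n p = -B.riemann l m n p := by
  simp only [riemann, riemannUp, B.curv_neg l m, Matrix.neg_apply, ← Finset.sum_neg_distrib]
  exact Finset.sum_congr rfl fun e _ => by ring

/-! ### The Weitzenböck identity -/

/-- The Hessian `∇_m ∂_n f`. -/
def hess (f : A) (m n : Fin 4) : A := B.d m (B.d n f) - ∑ l, B.Γ m l n * B.d l f

/-- The Laplace-Beltrami operator. -/
def laplacian (f : A) : A := ∑ m, ∑ n, B.h m n * B.hess f m n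

/-- `∂^μ f ∂_μ f`. -/
def gradSq (f : A) : A := ∑ m, ∑ n, B.h m n * B.d m f * B.d n f

/-- `|∇θ|²`; the sign comes from writing the contraction of the antisymmetric `∇_l θ` and `∇_k θ`
as a trace. -/
def normSqNablaθ : A :=
  -∑ l, ∑ k, B.h l k * (B.nablaθ l * B.g * B.nablaθ k * B.g).trace

lemma trace_nablaθ_ω_nablaθ_ω (l k : Fin 4) :
    (B.nablaθ l * B.ω * B.nablaθ k * B.ω).trace
      = B.E' * (B.nablaθ l * B.g * B.nablaθ k * B.g).trace + 2 * (B.d l B.σ * B.d k B.σ) := by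
  have h1 : B.nablaθ l * B.ω * B.nablaθ k * B.ω
      = B.nablaθ l * B.g * (B.h * B.ω * B.nablaθ k * B.ω) := by
    simp only [mul_assoc]
    rw [← mul_assoc B.g, B.g_mul_h, one_mul]
  have h2 : B.h * B.ω * B.nablaθ k * B.ω = -(B.h * B.nablaω k) := by
    rw [nablaω_eq, mul_neg, neg_neg]; simp only [mul_assoc]
  have h3 : B.nablaθ l * B.g * (B.h * B.ω) = B.nablaθ l * B.ω := by
    rw [mul_assoc, ← mul_assoc B.g, B.g_mul_h, one_mul]
  rw [h1, h2, h_mul_nablaω, neg_sub, sub_neg_eq_add, mul_add, Matrix.mul_smul, Matrix.mul_smul, h3,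
    Matrix.trace_add, Matrix.trace_smul, Matrix.trace_smul, trace_nablaθ_mul_ω, smul_eq_mul,
    smul_eq_mul, ← mul_assoc]
  ring

/-- The derivative of `tr(θ ∇_k ω) = -2 ∂_k σ`. -/
lemma trace_θ_mul_nabla2ω (l k : Fin 4) : (B.θ * B.nabla2ω l k).trace
    = -(2 * B.hess B.σ l k) + (B.nablaθ l * B.ω * B.nablaθ k * B.ω).trace := by
  have h1 := congrArg (B.d l) (B.trace_θ_mul_nablaω k)
  rw [Derivation.trace_mat, Derivation.mat_mul, Matrix.trace_add, map_neg, two_mul,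
    map_add] at h1
  have h2 : (B.nablaθ l * B.ω * B.nablaθ k * B.ω).trace
      = -(B.nablaθ l * B.nablaω k).trace := by
    rw [nablaω_eq, mul_neg, Matrix.trace_neg, neg_neg]; simp only [mul_assoc]
  have h3 : (B.θ * (∑ j, B.Γ l j k • B.nablaω j)).trace
      = -(2 * ∑ j, B.Γ l j k * B.d j B.σ) := by
    simp only [Finset.mul_sum, Matrix.trace_sum, Matrix.mul_smul, Matrix.trace_smul,
      trace_θ_mul_nablaω, smul_eq_mul, ← Finset.sum_neg_distrib]
    exact Finset.sum_congr rfl fun j _ => by ring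
  have h4 : (B.Γ l * B.θ * B.nablaω k).trace = (B.θ * (B.nablaω k * B.Γ l)).trace := by
    rw [mul_assoc, Matrix.trace_mul_comm, mul_assoc]
  rw [h2, nabla2ω, mul_sub, Matrix.trace_sub, h3, hess, mul_sub, mul_sub, Matrix.trace_sub,
    Matrix.trace_sub, nablaθ, add_mul, add_mul, Matrix.trace_add, Matrix.trace_add, h4, mul_assoc]
  linear_combination h1

lemma sum_h_trace_θ_mul_nabla2ω : ∑ l, ∑ k, B.h l k * (B.θ * B.nabla2ω l k).trace
    = -(2 * B.laplacian B.σ) - B.E' * B.normSqNablaθ + 2 * B.gradSq B.σ := by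
  simp only [trace_θ_mul_nabla2ω, trace_nablaθ_ω_nablaθ_ω, laplacian, normSqNablaθ, gradSq,
    mul_neg, sub_neg_eq_add, Finset.mul_sum, ← Finset.sum_add_distrib, ← Finset.sum_neg_distrib,
    ← Finset.sum_sub_distrib]
  exact Finset.sum_congr rfl fun l _ => Finset.sum_congr rfl fun k _ => by ring

/-- For a closed and co-closed form the rough Laplacian is a commutator of covariant
derivatives. -/
lemma sum_h_trace_θ_mul_nabla2ω_eq_curv : ∑ l, ∑ k, B.h l k * (B.θ * B.nabla2ω l k).trace
    = -(2 * ∑ l, ∑ k, ∑ m, ∑ n, B.h l k * B.θ m n *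
        ((B.curv l m)ᵀ * B.ω + B.ω * B.curv l m) n k) := by
  have h1 : ∀ l k, B.h l k * (B.θ * B.nabla2ω l k).trace
      = ∑ m, ∑ n, (B.h l k * B.θ m n * B.nabla2ω l m n k
        + B.h l k * B.θ m n * B.nabla2ω l n k m) := by
    intro l k
    simp only [Matrix.trace, Matrix.diag_apply, Matrix.mul_apply, Finset.mul_sum]
    refine Finset.sum_congr rfl fun m _ => Finset.sum_congr rfl fun n _ => ?_
    rw [B.nabla2ω_apply_neg l k m n]
    linear_combination (-B.h l k * B.θ m n) * B.nabla2ω_cyclic l k m n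
  have h2 : ∀ l k, ∑ m, ∑ n, B.h l k * B.θ m n * B.nabla2ω l n k m
      = ∑ m, ∑ n, B.h l k * B.θ m n * B.nabla2ω l m n k := by
    intro l k
    rw [Finset.sum_comm]
    refine Finset.sum_congr rfl fun m _ => Finset.sum_congr rfl fun n _ => ?_
    rw [B.θ_apply_neg m n, B.nabla2ω_apply_neg l m n k]
    ring
  have h3 : ∑ l, ∑ k, ∑ m, ∑ n, B.h l k * B.θ m n * B.nabla2ω m l n k = 0 := by
    rw [Finset.sum_congr rfl fun l _ => Finset.sum_comm, Finset.sum_comm]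
    refine Finset.sum_eq_zero fun m _ => ?_
    rw [Finset.sum_congr rfl fun l _ => Finset.sum_comm, Finset.sum_comm]
    refine Finset.sum_eq_zero fun n _ => ?_
    have h4 := congrArg (fun t => -B.θ m n * t) (B.sum_h_mul_nabla2ω m n)
    simp only [mul_zero, Finset.mul_sum] at h4
    rw [← h4]
    refine Finset.sum_congr rfl fun l _ => Finset.sum_congr rfl fun k _ => ?_
    rw [B.nabla2ω_apply_neg m l k n]
    ring
  have h5 : ∀ l k m n, B.h l k * B.θ m n * B.nabla2ω l m n k
      = B.h l k * B.θ m n * B.nabla2ω m l n k - B.h l k * B.θ m n *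
        ((B.curv l m)ᵀ * B.ω + B.ω * B.curv l m) n k := by
    intro l k m n
    have h6 := Matrix.ext_iff.mpr (B.nabla2ω_sub l m) n k
    rw [Matrix.sub_apply, Matrix.neg_apply] at h6
    linear_combination (B.h l k * B.θ m n) * h6
  simp only [h1, Finset.sum_add_distrib, h2]
  simp only [h5, Finset.sum_sub_distrib, h3]
  ring

/-- The first Bianchi identity relates the two ways to contract the Riemann tensor with `θ θ`. -/
lemma sum_θ_θ_riemann :
    ∑ l, ∑ p, ∑ m, ∑ n, B.θ l p * B.θ m n * B.riemann l m n p
      = -(algebraMap ℂ A (1 / 2) *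
          ∑ l, ∑ p, ∑ m, ∑ n, B.θ l p * B.θ m n * B.riemann l p m n) := by
  have h1 : ∑ l, ∑ p, ∑ m, ∑ n, (B.θ l p * B.θ m n * B.riemann l m n p
      + B.θ l p * B.θ m n * B.riemann m n l p + B.θ l p * B.θ m n * B.riemann n l m p) = 0 := by
    simp only [← mul_add, riemann_cyclic, mul_zero, Finset.sum_const_zero]
  have h2 : ∑ l, ∑ p, ∑ m, ∑ n, B.θ l p * B.θ m n * B.riemann m n l p
      = ∑ l, ∑ p, ∑ m, ∑ n, B.θ l p * B.θ m n * B.riemann l p m n := by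
    rw [Finset.sum_congr rfl fun l _ => Finset.sum_comm, Finset.sum_comm]
    refine Finset.sum_congr rfl fun l _ => ?_
    rw [Finset.sum_congr rfl fun k _ => Finset.sum_comm, Finset.sum_comm]
    exact Finset.sum_congr rfl fun k _ => Finset.sum_congr rfl fun m _ =>
      Finset.sum_congr rfl fun n _ => by ring
  have h3 : ∑ l, ∑ p, ∑ m, ∑ n, B.θ l p * B.θ m n * B.riemann n l m p
      = ∑ l, ∑ p, ∑ m, ∑ n, B.θ l p * B.θ m n * B.riemann l m n p := by
    refine Finset.sum_congr rfl fun l _ => Finset.sum_congr rfl fun p _ => ?_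
    rw [Finset.sum_comm]
    refine Finset.sum_congr rfl fun m _ => Finset.sum_congr rfl fun n _ => ?_
    rw [B.θ_apply_neg m n, B.riemann_neg l m n p]
    ring
  simp only [Finset.sum_add_distrib, h2, h3] at h1
  linear_combination algebraMap ℂ A (1 / 2) * h1
    - (∑ l, ∑ p, ∑ m, ∑ n, B.θ l p * B.θ m n * B.riemann l m n p) * two_mul_half (A := A)

lemma E_mul_sum_h_mul_curv_transpose_ω (l m n : Fin 4) :
    B.E * ∑ k, B.h l k * ((B.curv l m)ᵀ * B.ω) n k = -∑ p, B.θ l p * B.riemann l m n p := by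
  have h0 : B.E • (B.ω * B.h) = -(B.g * B.θ) := by
    rw [← Matrix.smul_mul, E_smul_ω, neg_mul, mul_assoc, B.g_mul_h, mul_one]
  have h1 : B.E * ∑ k, B.h l k * ((B.curv l m)ᵀ * B.ω) n k
      = ((B.curv l m)ᵀ * (B.E • (B.ω * B.h))) n l := by
    rw [Matrix.mul_smul, ← mul_assoc, Matrix.smul_apply, smul_eq_mul,
      Matrix.mul_apply (N := B.h)]
    congr 1
    exact Finset.sum_congr rfl fun k _ => by rw [B.h_apply_comm l k, mul_comm]
  have h2 : ∀ p, ((B.curv l m)ᵀ * B.g) n p = -B.riemann l m n p := by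
    intro p
    simp only [riemann, riemannUp, Matrix.mul_apply, Matrix.transpose_apply, neg_mul,
      Finset.sum_neg_distrib, neg_neg]
  rw [h1, h0, mul_neg, Matrix.neg_apply, ← mul_assoc, Matrix.mul_apply]
  congr 1
  refine Finset.sum_congr rfl fun p _ => ?_
  rw [h2, B.θ_apply_neg l p]
  ring

lemma E_mul_sum_curv_transpose_ω :
    B.E * ∑ l, ∑ k, ∑ m, ∑ n, B.h l k * B.θ m n * ((B.curv l m)ᵀ * B.ω) n k
      = -∑ l, ∑ p, ∑ m, ∑ n, B.θ l p * B.θ m n * B.riemann l m n p := by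
  have e3 : ∀ F : Fin 4 → Fin 4 → Fin 4 → Fin 4 → A,
      B.E * ∑ l, ∑ k, ∑ m, ∑ n, B.h l k * B.θ m n * F l m n k
        = ∑ l, ∑ m, ∑ n, B.θ m n * (B.E * ∑ k, B.h l k * F l m n k) := by
    intro F
    simp only [Finset.mul_sum]
    refine Finset.sum_congr rfl fun l _ => ?_
    rw [Finset.sum_comm]
    refine Finset.sum_congr rfl fun m _ => ?_
    rw [Finset.sum_comm]
    exact Finset.sum_congr rfl fun n _ => Finset.sum_congr rfl fun k _ => by ring
  rw [e3 fun l m n k => ((B.curv l m)ᵀ * B.ω) n k]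
  simp only [E_mul_sum_h_mul_curv_transpose_ω]
  simp only [mul_neg, Finset.mul_sum, Finset.sum_neg_distrib, neg_inj]
  refine Finset.sum_congr rfl fun l _ => ?_
  rw [Finset.sum_congr rfl fun l _ => Finset.sum_comm, Finset.sum_comm]
  exact Finset.sum_congr rfl fun p _ => Finset.sum_congr rfl fun m _ =>
    Finset.sum_congr rfl fun n _ => by ring

lemma sum_h_θ_ω_curv :
    ∑ l, ∑ k, ∑ m, ∑ n, B.h l k * B.θ m n * (B.ω * B.curv l m) n k = -B.scalarCurv := by
  have h1 : ∀ l k m, ∑ n, B.h l k * B.θ m n * (B.ω * B.curv l m) n k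
      = B.h l k * B.curv l m m k := by
    intro l k m
    simp only [mul_assoc]
    rw [← Finset.mul_sum, ← Matrix.mul_apply, ← mul_assoc, B.θ_mul_ω, one_mul]
  simp only [h1, scalarCurv, riemannUp, Finset.sum_neg_distrib, Finset.mul_sum, mul_neg, neg_neg]

/-- The commutator term of `sum_h_trace_θ_mul_nabla2ω_eq_curv`, in terms of the curvature of `g`. -/
lemma E_mul_sum_curv : B.E * ∑ l, ∑ k, ∑ m, ∑ n, B.h l k * B.θ m n *
        ((B.curv l m)ᵀ * B.ω + B.ω * B.curv l m) n k
      = algebraMap ℂ A (1 / 2) *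
          ∑ l, ∑ p, ∑ m, ∑ n, B.θ l p * B.θ m n * B.riemann l p m n
        - B.E * B.scalarCurv := by
  simp only [Matrix.add_apply, mul_add, Finset.sum_add_distrib]
  rw [E_mul_sum_curv_transpose_ω, sum_h_θ_ω_curv, sum_θ_θ_riemann]
  ring

lemma hess_E (m n : Fin 4) :
    B.hess B.E m n = B.E * B.hess B.σ m n + B.E * (B.d m B.σ * B.d n B.σ) := by
  simp only [hess, B.d_E, Derivation.leibniz, smul_eq_mul, mul_sub, Finset.mul_sum]
  have h1 : ∑ l, B.Γ m l n * (B.E * B.d l B.σ) = ∑ l, B.E * (B.Γ m l n * B.d l B.σ) :=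
    Finset.sum_congr rfl fun l _ => by ring
  rw [h1]
  ring

lemma laplacian_E : B.laplacian B.E = B.E * B.laplacian B.σ + B.E * B.gradSq B.σ := by
  simp only [laplacian, gradSq, hess_E, Finset.mul_sum, ← Finset.sum_add_distrib]
  exact Finset.sum_congr rfl fun l _ => Finset.sum_congr rfl fun k _ => by ring

/-- The Weitzenböck identity for the harmonic two-form `ω`, expressed through `θ`. -/
theorem normSqNablaθ_eq : B.normSqNablaθ
    = (∑ l, ∑ p, ∑ m, ∑ n, B.θ l p * B.θ m n * B.riemann l p m n) - 2 * (B.E * B.scalarCurv)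
      + 4 * (B.E * B.gradSq B.σ) - 2 * B.laplacian B.E := by
  have h1 := B.sum_h_trace_θ_mul_nabla2ω
  rw [sum_h_trace_θ_mul_nabla2ω_eq_curv] at h1
  have h2 := B.E_mul_sum_curv
  rw [laplacian_E]
  linear_combination B.E * h1 + 2 * h2 - B.normSqNablaθ * B.E_mul_E'
    + (∑ l, ∑ p, ∑ m, ∑ n, B.θ l p * B.θ m n * B.riemann l p m n) * two_mul_half (A := A)

/-! ### Embeddings, the second fundamental form and the Gauss equation -/

/-- The Poisson bracket. -/
def bracket (u v : A) : A := ∑ m, ∑ n, B.θ m n * B.d m u * B.d n v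

/-- Functions `x^a` which induce the metric `g` from the constant metric `η`. -/
structure Embedding (D : ℕ) where
  η : Matrix (Fin D) (Fin D) A
  x : Fin D → A
  η_symm : ηᵀ = η
  d_η : ∀ k, (B.d k).mat η = 0
  induced : ∀ m n, B.g m n = ∑ a, ∑ b, η a b * B.d m (x a) * B.d n (x b)

namespace Embedding

variable {B} {D : ℕ} (F : B.Embedding D)

/-- The Jacobian `∂_m x^a`. -/
def X : Matrix (Fin D) (Fin 4) A := Matrix.of fun a m => B.d m (F.x a)

/-- The second fundamental form `∇_l ∂_m x^a`, as a family of matrices indexed by `l`. -/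
def K (l : Fin 4) : Matrix (Fin D) (Fin 4) A := (B.d l).mat F.X - F.X * B.Γ l

lemma K_apply (l : Fin 4) (a : Fin D) (m : Fin 4) : F.K l a m = B.hess (F.x a) l m := by
  simp only [K, X, hess, Matrix.sub_apply, Derivation.mat_apply, Matrix.of_apply,
    Matrix.mul_apply]
  congr 1
  exact Finset.sum_congr rfl fun j _ => mul_comm _ _

lemma K_symm (l m : Fin 4) (a : Fin D) : F.K l a m = F.K m a l := by
  simp only [K_apply, hess, B.d_comm l m]
  congr 1
  exact Finset.sum_congr rfl fun j _ => by rw [B.Γ_symm j m l]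

lemma mat_X (l : Fin 4) : (B.d l).mat F.X = F.K l + F.X * B.Γ l := by
  simp only [K, sub_add_cancel]

lemma g_eq : B.g = F.Xᵀ * F.η * F.X := by
  ext m n
  simp only [F.induced, Matrix.mul_apply, Matrix.transpose_apply, X, Matrix.of_apply,
    Finset.sum_mul]
  rw [Finset.sum_comm]
  exact Finset.sum_congr rfl fun a _ => Finset.sum_congr rfl fun b _ => by ring

/-- The second fundamental form is normal. -/
lemma X_η_K (l : Fin 4) : F.Xᵀ * F.η * F.K l = 0 := by
  have hP : ∀ l n m, (F.Xᵀ * F.η * (B.d l).mat F.X) n m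
      = (F.Xᵀ * F.η * (B.d m).mat F.X) n l := by
    intro l n m
    rw [Matrix.mul_apply, Matrix.mul_apply]
    exact Finset.sum_congr rfl fun a _ => congrArg _ (B.d_comm l m _)
  have hg : ∀ l n m, B.d l (B.g n m) = (F.Xᵀ * F.η * (B.d l).mat F.X) n m
      + (F.Xᵀ * F.η * (B.d l).mat F.X) m n := by
    intro l n m
    have h1 := Matrix.ext_iff.mpr (congrArg (B.d l).mat F.g_eq) n m
    rw [Derivation.mat_mul, Derivation.mat_mul, F.d_η, Matrix.mul_zero, add_zero, Matrix.add_apply,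
      Derivation.mat_apply, Derivation.mat_transpose] at h1
    have h2 : ((B.d l).mat F.X)ᵀ * F.η * F.X = (F.Xᵀ * F.η * (B.d l).mat F.X)ᵀ := by
      simp only [Matrix.transpose_mul, F.η_symm, Matrix.transpose_transpose, Matrix.mul_assoc]
    rw [h1, h2, Matrix.transpose_apply, add_comm]
  have hgΓ : F.Xᵀ * F.η * (B.d l).mat F.X = B.g * B.Γ l := by
    ext n m
    rw [g_mul_Γ, hg, hg, hg, hP l m n, hP m l n, hP m n l]
    linear_combination (-(F.Xᵀ * F.η * (B.d l).mat F.X) n m) * two_mul_half (A := A)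
  rw [K, Matrix.mul_sub, hgΓ, ← Matrix.mul_assoc, ← F.g_eq, sub_self]

lemma K_η_X (l : Fin 4) : (F.K l)ᵀ * F.η * F.X = 0 := by
  have h1 := congrArg Matrix.transpose (F.X_η_K l)
  simpa only [Matrix.transpose_mul, F.η_symm, Matrix.transpose_transpose, Matrix.transpose_zero,
    Matrix.mul_assoc] using h1

/-- The Gauss equation. -/
lemma g_mul_curv (l k : Fin 4) :
    B.g * B.curv l k = (F.K l)ᵀ * F.η * F.K k - (F.K k)ᵀ * F.η * F.K l := by
  have h1 : ∀ l k, F.Xᵀ * F.η * (B.d l).mat (F.K k) = -((F.K l)ᵀ * F.η * F.K k) := by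
    intro l k
    have h2 := congrArg (B.d l).mat (F.X_η_K k)
    rw [Derivation.mat_mul, Derivation.mat_mul, F.d_η, Matrix.mul_zero, add_zero,
      Derivation.mat_transpose, mat_X, Matrix.transpose_add, Matrix.add_mul, Matrix.add_mul,
      Matrix.transpose_mul, Matrix.mul_assoc (B.Γ l)ᵀ, Matrix.mul_assoc (B.Γ l)ᵀ, X_η_K,
      Matrix.mul_zero, add_zero] at h2
    have h3 : (B.d l).mat (0 : Matrix (Fin 4) (Fin 4) A) = 0 := by ext i j; simp
    rw [h3] at h2
    exact eq_neg_of_add_eq_zero_right h2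
  have h2 : (B.d l).mat ((B.d k).mat F.X) = (B.d k).mat ((B.d l).mat F.X) := by
    ext i j; exact B.d_comm l k _
  have h3 : (B.d l).mat (F.K k) - (B.d k).mat (F.K l)
      = F.K k * B.Γ l - F.K l * B.Γ k - F.X * B.curv l k := by
    have e1 : ∀ l k, (B.d l).mat (F.K k) = (B.d l).mat ((B.d k).mat F.X)
        - (F.K l * B.Γ k + F.X * (B.Γ l * B.Γ k) + F.X * (B.d l).mat (B.Γ k)) := by
      intro l k
      conv_lhs => rw [K, Derivation.mat_sub, Derivation.mat_mul, mat_X F l]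
      rw [Matrix.add_mul, Matrix.mul_assoc]
    rw [e1, e1, h2, curv]
    simp only [Matrix.mul_sub, Matrix.mul_add]
    abel
  have h4 := congrArg (F.Xᵀ * F.η * ·) h3
  simp only [Matrix.mul_sub, h1, ← Matrix.mul_assoc, X_η_K, Matrix.zero_mul, ← F.g_eq] at h4
  have h5 : B.g * B.curv l k = -(0 - 0 - B.g * B.curv l k) := by abel
  rw [h5, ← h4]
  abel

/-- `□x^a □x_a`. -/
def boxSq : A := ∑ a, ∑ b, F.η a b * B.laplacian (F.x a) * B.laplacian (F.x b)

/-- The square of the second fundamental form. -/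
def normSqK : A := ∑ l, ∑ k, B.h l k * ((F.K l)ᵀ * F.η * F.K k * B.h).trace

lemma K_η_K_apply (l k m n : Fin 4) :
    ((F.K l)ᵀ * F.η * F.K k) m n = ∑ a, ∑ b, F.η a b * F.K l a m * F.K k b n := by
  simp only [Matrix.mul_apply, Matrix.transpose_apply, Finset.sum_mul]
  rw [Finset.sum_comm]
  exact Finset.sum_congr rfl fun a _ => Finset.sum_congr rfl fun b _ => by ring

/-- The contracted Gauss equation. -/
lemma normSqK_eq : F.normSqK = F.boxSq - B.scalarCurv := by
  have h1 : ∀ n m l, B.curv n m m l = ∑ p, B.h m p * ((F.K n)ᵀ * F.η * F.K m) p l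
      - ∑ p, B.h m p * ((F.K m)ᵀ * F.η * F.K n) p l := by
    intro n m l
    have h2 : B.curv n m = B.h * (B.g * B.curv n m) := by
      rw [← mul_assoc, B.h_mul_g, one_mul]
    rw [h2, g_mul_curv, Matrix.mul_apply, ← Finset.sum_sub_distrib]
    exact Finset.sum_congr rfl fun p _ => by rw [Matrix.sub_apply, mul_sub]
  have h2 : B.scalarCurv = ∑ n, ∑ l, B.h n l * ∑ m, ∑ p, B.h m p *
      ((F.K m)ᵀ * F.η * F.K n) p l
      - ∑ n, ∑ l, B.h n l * ∑ m, ∑ p, B.h m p * ((F.K n)ᵀ * F.η * F.K m) p l := by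
    simp only [scalarCurv, riemannUp, h1, neg_sub]
    simp only [← Finset.sum_sub_distrib, ← mul_sub]
  have h3 : ∑ n, ∑ l, B.h n l * ∑ m, ∑ p, B.h m p * ((F.K n)ᵀ * F.η * F.K m) p l
      = F.normSqK := by
    simp only [normSqK, Matrix.trace, Matrix.diag_apply, Matrix.mul_apply (N := B.h)]
    refine Finset.sum_congr rfl fun n _ => Finset.sum_congr rfl fun l _ => ?_
    congr 1
    rw [Finset.sum_comm]
    refine Finset.sum_congr rfl fun p _ => Finset.sum_congr rfl fun m _ => ?_
    have h4 : ((F.K n)ᵀ * F.η * F.K m) p l = ((F.K n)ᵀ * F.η * F.K l) p m := by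
      simp only [K_η_K_apply, F.K_symm m l]
    rw [h4, mul_comm]
  have h5 : ∑ n, ∑ l, B.h n l * ∑ m, ∑ p, B.h m p * ((F.K m)ᵀ * F.η * F.K n) p l
      = F.boxSq := by
    have h6 : ∀ a, B.laplacian (F.x a) = ∑ m, ∑ p, B.h m p * F.K m a p := by
      intro a; simp only [laplacian, K_apply]
    calc _ = ∑ n, ∑ l, ∑ a, ∑ b, ∑ m, ∑ p,
          B.h n l * (B.h m p * (F.η a b * F.K m a p * F.K n b l)) := by
          simp only [K_η_K_apply, Finset.mul_sum]
          refine Finset.sum_congr rfl fun n _ => Finset.sum_congr rfl fun l _ => ?_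
          rw [Finset.sum_congr rfl fun m _ => Finset.sum_comm, Finset.sum_comm]
          refine Finset.sum_congr rfl fun a _ => ?_
          rw [Finset.sum_congr rfl fun m _ => Finset.sum_comm, Finset.sum_comm]
      _ = ∑ a, ∑ b, ∑ n, ∑ l, ∑ m, ∑ p,
          B.h n l * (B.h m p * (F.η a b * F.K m a p * F.K n b l)) := by
          rw [Finset.sum_congr rfl fun m _ => Finset.sum_comm, Finset.sum_comm]
          refine Finset.sum_congr rfl fun a _ => ?_
          rw [Finset.sum_congr rfl fun m _ => Finset.sum_comm, Finset.sum_comm]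
      _ = _ := by
          rw [boxSq]
          refine Finset.sum_congr rfl fun a _ => Finset.sum_congr rfl fun b _ => ?_
          rw [h6, h6]
          simp only [Finset.mul_sum, Finset.sum_mul]
          refine Finset.sum_congr rfl fun n _ => Finset.sum_congr rfl fun l _ =>
            Finset.sum_congr rfl fun m _ => Finset.sum_congr rfl fun p _ => by ring
  rw [h2, h3, h5]
  ring

/-! ### Brackets of the embedding functions -/

lemma bracket_x (a : Fin D) (u : A) :
    B.bracket (F.x a) u = ∑ n, (F.X * B.θ) a n * B.d n u := by
  simp only [bracket, Matrix.mul_apply, X, Matrix.of_apply, Finset.sum_mul]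
  rw [Finset.sum_comm]
  exact Finset.sum_congr rfl fun m _ => Finset.sum_congr rfl fun n _ => by ring

lemma θ_X_η_X_θ : (F.X * B.θ)ᵀ * F.η * (F.X * B.θ) = B.E • B.h := by
  have h1 : (F.X * B.θ)ᵀ * F.η * (F.X * B.θ) = B.θᵀ * (F.Xᵀ * F.η * F.X) * B.θ := by
    simp only [Matrix.transpose_mul, Matrix.mul_assoc]
  rw [h1, ← F.g_eq, B.θ_antisymm, neg_mul, neg_mul, B.selfDual, neg_neg]

/-- `{x^b, {x_b, f}} = e^σ □ f`. -/
theorem sum_bracket_bracket (f : A) :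
    ∑ b, ∑ b', F.η b b' * B.bracket (F.x b) (B.bracket (F.x b') f) = B.E * B.laplacian f := by
  -- The gradient of `f` as a column.
  let V : Matrix (Fin 4) (Fin 1) A := Matrix.of fun k _ => B.d k f
  have hV : ∀ b, B.bracket (F.x b) f = (F.X * B.θ * V) b 0 := by
    intro b
    rw [bracket_x, Matrix.mul_apply (M := F.X * B.θ)]
    rfl
  have h1 : ∀ n, (B.d n).mat (F.X * B.θ * V) = F.K n * (B.θ * V)
      + F.X * (B.nablaθ n * V + B.θ * ((B.d n).mat V - (B.Γ n)ᵀ * V)) := by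
    intro n
    rw [Derivation.mat_mul, Derivation.mat_mul, mat_X, nablaθ]
    simp only [Matrix.mul_add, Matrix.add_mul, Matrix.mul_sub, Matrix.mul_assoc]
    abel
  have h2 : ∀ n, (F.X * B.θ)ᵀ * F.η * (B.d n).mat (F.X * B.θ * V)
      = -((B.θ * B.g * B.nablaθ n) * V) + B.E • (B.h * ((B.d n).mat V - (B.Γ n)ᵀ * V)) := by
    intro n
    have e1 : (F.X * B.θ)ᵀ * F.η * (B.d n).mat (F.X * B.θ * V)
        = B.θᵀ * (F.Xᵀ * F.η * F.K n) * (B.θ * V) + B.θᵀ * (F.Xᵀ * F.η * F.X) * B.nablaθ n * V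
          + ((F.X * B.θ)ᵀ * F.η * (F.X * B.θ)) * ((B.d n).mat V - (B.Γ n)ᵀ * V) := by
      rw [h1, Matrix.transpose_mul]
      simp only [Matrix.mul_add, Matrix.mul_assoc, add_assoc]
    rw [e1, X_η_K, ← F.g_eq, θ_X_η_X_θ, B.θ_antisymm, Matrix.mul_zero, Matrix.zero_mul, zero_add,
      neg_mul, neg_mul, Matrix.neg_mul, Matrix.smul_mul]
  have h3 : ∑ b, ∑ b', F.η b b' * B.bracket (F.x b) (B.bracket (F.x b') f)
      = ∑ n, ((F.X * B.θ)ᵀ * F.η * (B.d n).mat (F.X * B.θ * V)) n 0 := by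
    have e1 : ∀ n, ((F.X * B.θ)ᵀ * F.η * (B.d n).mat (F.X * B.θ * V)) n 0
        = ∑ b, ∑ b', F.η b b' * ((F.X * B.θ) b n * B.d n ((F.X * B.θ * V) b' 0)) := by
      intro n
      rw [Matrix.mul_apply]
      simp only [Matrix.mul_apply (M := (F.X * B.θ)ᵀ), Matrix.transpose_apply, Finset.sum_mul,
        Derivation.mat_apply]
      rw [Finset.sum_comm]
      exact Finset.sum_congr rfl fun b _ => Finset.sum_congr rfl fun b' _ => by ring
    simp only [e1, hV]
    simp only [bracket_x, Finset.mul_sum]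
    rw [Finset.sum_congr rfl fun m _ => Finset.sum_comm, Finset.sum_comm]
  rw [h3]
  simp only [h2, Matrix.add_apply, Matrix.neg_apply, Finset.sum_add_distrib,
    Finset.sum_neg_distrib]
  have h4 : ∑ n, (B.θ * B.g * B.nablaθ n * V) n 0 = 0 := by
    simp only [Matrix.mul_apply (N := V)]
    rw [Finset.sum_comm]
    simp only [← Finset.sum_mul, sum_θ_g_nablaθ, zero_mul, Finset.sum_const_zero]
  rw [h4, neg_zero, zero_add, laplacian, Finset.mul_sum]
  refine Finset.sum_congr rfl fun n _ => ?_
  rw [Matrix.smul_apply, smul_eq_mul, Matrix.mul_apply]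
  rfl

lemma sum_η_bracket_mul_bracket (u v : A) :
    ∑ c, ∑ c', F.η c c' * (B.bracket (F.x c) u * B.bracket (F.x c') v)
      = B.E * ∑ l, ∑ k, B.h l k * (B.d l u * B.d k v) := by
  have h1 : ∀ l k, B.E * B.h l k
      = ∑ c, ∑ c', F.η c c' * ((F.X * B.θ) c l * (F.X * B.θ) c' k) := by
    intro l k
    rw [← smul_eq_mul, ← Matrix.smul_apply, ← F.θ_X_η_X_θ, Matrix.mul_apply]
    simp only [Matrix.mul_apply (M := (F.X * B.θ)ᵀ), Matrix.transpose_apply, Finset.sum_mul]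
    rw [Finset.sum_comm]
    exact Finset.sum_congr rfl fun b _ => Finset.sum_congr rfl fun b' _ => by ring
  simp only [Finset.mul_sum, ← mul_assoc, h1]
  simp only [bracket_x, Finset.mul_sum, Finset.sum_mul]
  symm
  rw [Finset.sum_congr rfl fun m _ => Finset.sum_comm, Finset.sum_comm]
  refine Finset.sum_congr rfl fun c _ => ?_
  rw [Finset.sum_congr rfl fun m _ => Finset.sum_comm, Finset.sum_comm]
  refine Finset.sum_congr rfl fun c' _ => ?_
  rw [Finset.sum_comm]
  refine Finset.sum_congr rfl fun k _ => Finset.sum_congr rfl fun l _ => by ring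

lemma bracket_x_x (a b : Fin D) : B.bracket (F.x a) (F.x b) = (F.X * B.θ * F.Xᵀ) a b := by
  rw [bracket_x, Matrix.mul_apply (M := F.X * B.θ)]
  rfl

lemma mat_X_θ_X (l : Fin 4) : (B.d l).mat (F.X * B.θ * F.Xᵀ)
    = F.X * B.nablaθ l * F.Xᵀ + F.K l * B.θ * F.Xᵀ + F.X * B.θ * (F.K l)ᵀ := by
  rw [Derivation.mat_mul, Derivation.mat_mul, Derivation.mat_transpose, mat_X, nablaθ]
  simp only [Matrix.mul_add, Matrix.add_mul, Matrix.mul_assoc, Matrix.transpose_add,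
    Matrix.transpose_mul]
  abel

/-- Since the second fundamental form is normal, no mixed terms occur when the derivative of
`{x^a, x^b}` is squared. -/
lemma trace_mat_X_θ_X (l k : Fin 4) :
    (((B.d l).mat (F.X * B.θ * F.Xᵀ))ᵀ * F.η * (B.d k).mat (F.X * B.θ * F.Xᵀ) * F.η).trace
      = -(B.nablaθ l * B.g * B.nablaθ k * B.g).trace
        + B.E * ((F.K l)ᵀ * F.η * F.K k * B.h).trace
        + B.E * ((F.K k)ᵀ * F.η * F.K l * B.h).trace := by
  have hX := F.X_η_K
  have hK := F.K_η_X
  have e1 : ((B.d l).mat (F.X * B.θ * F.Xᵀ))ᵀ * F.η * (B.d k).mat (F.X * B.θ * F.Xᵀ)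
      = -(F.X * (B.nablaθ l * B.g * B.nablaθ k) * F.Xᵀ)
        - F.X * (B.nablaθ l * B.g * B.θ) * (F.K k)ᵀ
        - F.X * (B.θ * ((F.K l)ᵀ * F.η * F.K k) * B.θ) * F.Xᵀ
        - F.K l * (B.θ * B.g * B.nablaθ k) * F.Xᵀ
        - F.K l * (B.θ * B.g * B.θ) * (F.K k)ᵀ := by
    have e2 : ((B.d l).mat (F.X * B.θ * F.Xᵀ))ᵀ
        = -(F.X * B.nablaθ l * F.Xᵀ) - F.X * B.θ * (F.K l)ᵀ - F.K l * B.θ * F.Xᵀ := by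
      rw [mat_X_θ_X]
      simp only [Matrix.transpose_add, Matrix.transpose_mul, Matrix.transpose_transpose,
        B.θ_antisymm, B.nablaθ_antisymm, Matrix.mul_neg, Matrix.neg_mul, Matrix.mul_assoc]
      abel
    have h1 : ∀ {p : Type} [Fintype p] (M : Matrix (Fin 4) p A),
        F.Xᵀ * (F.η * (F.K k * M)) = 0 := fun M => by
      rw [← Matrix.mul_assoc, ← Matrix.mul_assoc, hX, Matrix.zero_mul]
    have h2 : ∀ {p : Type} [Fintype p] (M : Matrix (Fin 4) p A),
        (F.K l)ᵀ * (F.η * (F.X * M)) = 0 := fun M => by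
      rw [← Matrix.mul_assoc, ← Matrix.mul_assoc, hK, Matrix.zero_mul]
    rw [e2, mat_X_θ_X, F.g_eq]
    simp only [Matrix.mul_add, Matrix.sub_mul, Matrix.neg_mul, Matrix.mul_assoc, h1, h2,
      Matrix.mul_zero]
    abel
  have t : ∀ (P Q : Matrix (Fin D) (Fin 4) A) (M : Matrix (Fin 4) (Fin 4) A),
      (P * M * Qᵀ * F.η).trace = (M * (Qᵀ * F.η * P)).trace := by
    intro P Q M
    rw [Matrix.mul_assoc P, Matrix.mul_assoc P, Matrix.trace_mul_comm]
    simp only [Matrix.mul_assoc]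
  have t3 : (B.θ * ((F.K l)ᵀ * F.η * F.K k) * B.θ * B.g).trace
      = -(B.E * ((F.K l)ᵀ * F.η * F.K k * B.h).trace) := by
    have h1 : B.θ * ((F.K l)ᵀ * F.η * F.K k) * B.θ * B.g
        = B.θ * (((F.K l)ᵀ * F.η * F.K k) * (B.θ * B.g)) := by
      rw [mul_assoc, mul_assoc]
    rw [h1, Matrix.trace_mul_comm, mul_assoc ((F.K l)ᵀ * F.η * F.K k), B.selfDual, mul_neg,
      Matrix.trace_neg, Matrix.mul_smul, Matrix.trace_smul, smul_eq_mul]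
  have t5 : (B.θ * B.g * B.θ * ((F.K k)ᵀ * F.η * F.K l)).trace
      = -(B.E * ((F.K k)ᵀ * F.η * F.K l * B.h).trace) := by
    rw [B.selfDual, neg_mul, Matrix.trace_neg, Matrix.smul_mul, Matrix.trace_smul, smul_eq_mul,
      Matrix.trace_mul_comm]
  rw [e1]
  simp only [Matrix.sub_mul, Matrix.neg_mul, Matrix.trace_sub, Matrix.trace_neg, t, hK, hX,
    ← F.g_eq, Matrix.mul_zero, Matrix.trace_zero, t3, t5]
  ring

/-- `{x^c, {x^a, x^b}} {x_c, {x_a, x_b}}`. -/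
theorem sum_bracket_bracket_sq :
    ∑ a, ∑ a', ∑ b, ∑ b', ∑ c, ∑ c', F.η a a' * F.η b b' * F.η c c' *
        (B.bracket (F.x c) (B.bracket (F.x a) (F.x b)) *
          B.bracket (F.x c') (B.bracket (F.x a') (F.x b')))
      = B.E * B.normSqNablaθ + 2 * B.E ^ 2 * F.normSqK := by
  have h1 : ∀ l k, (((B.d l).mat (F.X * B.θ * F.Xᵀ))ᵀ * F.η *
        (B.d k).mat (F.X * B.θ * F.Xᵀ) * F.η).trace
      = ∑ a, ∑ a', ∑ b, ∑ b', F.η a a' * F.η b b' *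
          (B.d l (B.bracket (F.x a) (F.x b)) * B.d k (B.bracket (F.x a') (F.x b'))) := by
    intro l k
    simp only [Matrix.trace, Matrix.diag_apply, bracket_x_x,
      Matrix.mul_apply (M := ((B.d l).mat (F.X * B.θ * F.Xᵀ))ᵀ),
      Matrix.mul_apply (M := ((B.d l).mat (F.X * B.θ * F.Xᵀ))ᵀ * F.η),
      Matrix.mul_apply (N := F.η), Matrix.transpose_apply, Finset.sum_mul,
      Derivation.mat_apply]
    rw [Finset.sum_congr rfl fun m _ => Finset.sum_congr rfl fun m _ => Finset.sum_comm,
      Finset.sum_congr rfl fun m _ => Finset.sum_comm, Finset.sum_comm]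
    refine Finset.sum_congr rfl fun a _ => ?_
    rw [Finset.sum_congr rfl fun m _ => Finset.sum_comm, Finset.sum_comm]
    refine Finset.sum_congr rfl fun a' _ => Finset.sum_congr rfl fun b _ =>
      Finset.sum_congr rfl fun b' _ => ?_
    rw [show F.η b' b = F.η b b' from Matrix.ext_iff.mpr F.η_symm b b']
    ring
  have h2 : ∀ a a' b b', ∑ c, ∑ c', F.η a a' * F.η b b' * F.η c c' *
        (B.bracket (F.x c) (B.bracket (F.x a) (F.x b)) *
          B.bracket (F.x c') (B.bracket (F.x a') (F.x b')))
      = ∑ l, ∑ k, B.E * (B.h l k * (F.η a a' * F.η b b' *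
          (B.d l (B.bracket (F.x a) (F.x b)) * B.d k (B.bracket (F.x a') (F.x b'))))) := by
    intro a a' b b'
    simp only [mul_assoc (F.η a a' * F.η b b')]
    simp only [← Finset.mul_sum, sum_η_bracket_mul_bracket]
    simp only [Finset.mul_sum]
    exact Finset.sum_congr rfl fun l _ => Finset.sum_congr rfl fun k _ => by ring
  have h3 : ∑ l, ∑ k, B.h l k * ((F.K k)ᵀ * F.η * F.K l * B.h).trace = F.normSqK := by
    rw [normSqK, Finset.sum_comm]
    exact Finset.sum_congr rfl fun l _ => Finset.sum_congr rfl fun k _ => by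
      rw [B.h_apply_comm]
  calc _ = ∑ l, ∑ k, B.E * (B.h l k * (((B.d l).mat (F.X * B.θ * F.Xᵀ))ᵀ * F.η *
        (B.d k).mat (F.X * B.θ * F.Xᵀ) * F.η).trace) := by
        simp only [h2, h1, Finset.mul_sum]
        symm
        rw [Finset.sum_congr rfl fun l _ => Finset.sum_comm, Finset.sum_comm]
        refine Finset.sum_congr rfl fun a _ => ?_
        rw [Finset.sum_congr rfl fun l _ => Finset.sum_comm, Finset.sum_comm]
        refine Finset.sum_congr rfl fun a' _ => ?_
        rw [Finset.sum_congr rfl fun l _ => Finset.sum_comm, Finset.sum_comm]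
        refine Finset.sum_congr rfl fun b _ => ?_
        rw [Finset.sum_congr rfl fun l _ => Finset.sum_comm, Finset.sum_comm]
    _ = B.E * (B.normSqNablaθ + B.E * F.normSqK + B.E *
          ∑ l, ∑ k, B.h l k * ((F.K k)ᵀ * F.η * F.K l * B.h).trace) := by
        simp only [trace_mat_X_θ_X, normSqNablaθ, normSqK, Finset.mul_sum,
          ← Finset.sum_add_distrib, ← Finset.sum_neg_distrib]
        exact Finset.sum_congr rfl fun l _ => Finset.sum_congr rfl fun k _ => by ring
    _ = _ := by rw [h3]; ring

end Embedding
/-! ### The semi-classical density of the action -/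

/-- The semi-classical symbol of an observable, with values in the algebra of functions. -/
def symbol {D : ℕ} (x : Fin D → A) : MatrixObs D → A
  | .X a => x a
  | .smul c O => c • symbol x O
  | .add O P => symbol x O + symbol x P
  | .sum O => ∑ a, symbol x (O a)
  | .mul O P => symbol x O * symbol x P
  | .comm O P => Complex.I • B.bracket (symbol x O) (symbol x P)

section

variable {D : ℕ} (x : Fin D → A)

lemma symbol_X (a : Fin D) : B.symbol x (.X a) = x a := rfl

lemma symbol_smul (c : ℂ) (O : MatrixObs D) : B.symbol x (.smul c O) = c • B.symbol x O := rfl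

lemma symbol_add (O P : MatrixObs D) :
    B.symbol x (.add O P) = B.symbol x O + B.symbol x P := rfl

lemma symbol_sum (O : Fin D → MatrixObs D) :
    B.symbol x (.sum O) = ∑ a, B.symbol x (O a) := rfl

lemma symbol_mul (O P : MatrixObs D) :
    B.symbol x (.mul O P) = B.symbol x O * B.symbol x P := rfl

end

lemma bracket_smul (c : ℂ) (u v : A) : B.bracket u (c • v) = c • B.bracket u v := by
  simp only [bracket, Derivation.map_smul, mul_smul_comm, Finset.smul_sum]

lemma symbol_comm_comm {D : ℕ} (x : Fin D → A) (O P Q : MatrixObs D) :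
    B.symbol x (.comm O (.comm P Q))
      = -B.bracket (B.symbol x O) (B.bracket (B.symbol x P) (B.symbol x Q)) := by
  simp only [symbol, bracket_smul, smul_smul, Complex.I_mul_I, neg_smul, one_smul]

namespace Embedding

variable {B} {D : ℕ} (F : B.Embedding D) {η : Matrix (Fin D) (Fin D) ℝ}

lemma symbol_box (hη : ∀ a b, F.η a b = algebraMap ℂ A (η a b)) (a : Fin D) :
    B.symbol F.x (.box η a) = -(B.E * B.laplacian (F.x a)) := by
  rw [← F.sum_bracket_bracket, MatrixObs.box]
  simp only [symbol_sum, symbol_smul, symbol_comm_comm, symbol_X, hη, Algebra.smul_def,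
    mul_neg, Finset.sum_neg_distrib]

lemma symbol_boxBox (hη : ∀ a b, F.η a b = algebraMap ℂ A (η a b)) :
    B.symbol F.x (.boxBox η) = B.E ^ 2 * F.boxSq := by
  rw [MatrixObs.boxBox, boxSq]
  simp only [symbol_sum, symbol_smul, symbol_mul, F.symbol_box hη, hη, Algebra.smul_def,
    Finset.mul_sum]
  exact Finset.sum_congr rfl fun a _ => Finset.sum_congr rfl fun b _ => by ring

lemma symbol_doubleCommSq (hη : ∀ a b, F.η a b = algebraMap ℂ A (η a b)) :
    B.symbol F.x (.doubleCommSq η) = B.E * B.normSqNablaθ + 2 * B.E ^ 2 * F.normSqK := by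
  rw [← F.sum_bracket_bracket_sq, MatrixObs.doubleCommSq]
  simp only [symbol_sum, symbol_smul, symbol_mul, symbol_comm_comm, symbol_X, hη,
    Algebra.smul_def, map_mul, neg_mul_neg]

/-- The semi-classical density of the action is a sum of the extrinsic term, the intrinsic
density and a multiple of `√g □ e^σ`. -/
theorem rho_mul_symbol_orderSix (hη : ∀ a b, F.η a b = algebraMap ℂ A (η a b)) (α β : ℂ)
    {rho s : A} (hs : rho * B.E = s) : rho * B.symbol F.x (.orderSix η α β)
      = algebraMap ℂ A (α + β) * (s * B.E * F.boxSq)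
        + algebraMap ℂ A β * (s * (algebraMap ℂ A (1 / 2) *
            (∑ l, ∑ p, ∑ m, ∑ n, B.θ l p * B.θ m n * B.riemann l p m n)
            - 2 * B.E * B.scalarCurv + 2 * B.E * B.gradSq B.σ) - s * B.laplacian B.E) := by
  have h1 : algebraMap ℂ A (β / 2) = algebraMap ℂ A β * algebraMap ℂ A (1 / 2) := by
    rw [← map_mul]; congr 1; ring
  rw [MatrixObs.orderSix]
  simp only [symbol_add, symbol_smul, F.symbol_boxBox hη, F.symbol_doubleCommSq hη,
    Algebra.smul_def, normSqK_eq, normSqNablaθ_eq, h1, ← hs, map_add]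
  linear_combination (rho * B.E * algebraMap ℂ A β *
    (-B.E * B.scalarCurv + 2 * B.E * B.gradSq B.σ - B.laplacian B.E
      + B.E * (F.boxSq - B.scalarCurv))) * two_mul_half (A := A)

end Embedding

/-- The density `√g` is parallel. -/
lemma d_sqrt {s : A} (hs : s ^ 2 = B.g.det) (k : Fin 4) : B.d k s = s * (B.Γ k).trace := by
  have hu : B.g.det * B.h.det = 1 := by rw [← Matrix.det_mul, B.g_mul_h, Matrix.det_one]
  have hadj : B.g.adjugate = s ^ 2 • B.h := by
    calc B.g.adjugate = B.g.adjugate * (B.g * B.h) := by rw [B.g_mul_h, mul_one]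
      _ = _ := by rw [← mul_assoc, Matrix.adjugate_mul, Matrix.smul_mul, one_mul, hs]
  have h1 := (B.d k).det_eq_trace_adjugate B.g
  have h2 : (B.h * (B.d k).mat B.g).trace = 2 * (B.Γ k).trace := by
    rw [mat_g, mul_add, ← mul_assoc, B.h_mul_g, one_mul, Matrix.trace_add,
      Matrix.trace_mul_comm B.h, mul_assoc, B.g_mul_h, mul_one, Matrix.trace_transpose, two_mul]
  rw [hadj, Matrix.smul_mul, Matrix.trace_smul, h2, ← hs, sq, Derivation.leibniz] at h1
  simp only [smul_eq_mul] at h1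
  rw [← hs] at hu
  linear_combination (s * B.h.det * algebraMap ℂ A (1 / 2)) * h1
    - (B.d k s - s * (B.Γ k).trace) * hu
    - (B.d k s - s * (B.Γ k).trace) * s ^ 2 * B.h.det * two_mul_half (A := A)

/-- `∂_m (√g g^{mn} ∂_n f) = √g □ f`. -/
theorem sum_d_sqrt_mul_grad {s : A} (hs : s ^ 2 = B.g.det) (f : A) :
    ∑ m, B.d m (s * ∑ n, B.h m n * B.d n f) = s * B.laplacian f := by
  have h1 : ∀ m n, B.d m (B.h m n * B.d n f) = B.h m n * B.d m (B.d n f)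
      - ∑ j, B.Γ m m j * (B.h j n * B.d n f) - ∑ j, B.h m j * B.Γ m n j * B.d n f := by
    intro m n
    have e1 : B.d n f * ∑ j, (B.Γ m m j * B.h j n + B.h m j * B.Γ m n j)
        = ∑ j, B.Γ m m j * (B.h j n * B.d n f) + ∑ j, B.h m j * B.Γ m n j * B.d n f := by
      rw [Finset.mul_sum, ← Finset.sum_add_distrib]
      exact Finset.sum_congr rfl fun j _ => by ring
    rw [Derivation.leibniz, smul_eq_mul, smul_eq_mul, d_h_apply]
    linear_combination -e1
  have h2 : ∑ m, ∑ n, ∑ j, B.Γ m m j * (B.h j n * B.d n f)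
      = ∑ m, ∑ n, (B.Γ m).trace * (B.h m n * B.d n f) := by
    rw [Finset.sum_congr rfl fun m _ => Finset.sum_comm, Finset.sum_comm]
    refine Finset.sum_congr rfl fun j _ => ?_
    rw [Finset.sum_comm]
    refine Finset.sum_congr rfl fun n _ => ?_
    simp only [Matrix.trace, Matrix.diag_apply, B.Γ_symm _ j, Finset.sum_mul]
  have h3 : ∑ m, ∑ n, ∑ j, B.h m j * B.Γ m n j * B.d n f
      = ∑ m, ∑ n, ∑ j, B.h m n * (B.Γ m j n * B.d j f) := by
    refine Finset.sum_congr rfl fun m _ => ?_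
    rw [Finset.sum_comm]
    exact Finset.sum_congr rfl fun n _ => Finset.sum_congr rfl fun j _ => by ring
  have h4 : B.laplacian f = ∑ m, ∑ n, B.h m n * B.d m (B.d n f)
      - ∑ m, ∑ n, ∑ j, B.h m n * (B.Γ m j n * B.d j f) := by
    simp only [laplacian, hess, mul_sub, Finset.sum_sub_distrib, Finset.mul_sum]
  have h5 : ∀ m, B.d m (s * ∑ n, B.h m n * B.d n f)
      = s * (∑ n, B.d m (B.h m n * B.d n f) + ∑ n, (B.Γ m).trace * (B.h m n * B.d n f)) := by
    intro m
    rw [Derivation.leibniz, B.d_sqrt hs, map_sum, ← Finset.mul_sum, smul_eq_mul, smul_eq_mul]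
    ring
  simp only [h5, ← Finset.mul_sum, Finset.sum_add_distrib, h1, Finset.sum_sub_distrib] at h2 h3 h4 ⊢
  rw [h4]
  linear_combination (-s) * h2 - s * h3

end SelfDualPoisson

/-! ### The differential algebra of smooth functions on an open set -/

/-- A function on `U` as a function on the coordinate space, by zero outside `U`. -/
def extendZero (U : Set Coord) (f : U → ℂ) : Coord → ℂ := Function.extend Subtype.val f 0

lemma extendZero_apply {U : Set Coord} (f : U → ℂ) {p : Coord} (hp : p ∈ U) :
    extendZero U f p = f ⟨p, hp⟩ :=
  Subtype.val_injective.extend_apply f 0 ⟨p, hp⟩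

lemma pd_congr {U : Set Coord} (hU : IsOpen U) {f f' : Coord → ℂ} (h : Set.EqOn f f' U)
    (μ : Fin 4) {p : Coord} (hp : p ∈ U) : pd μ f p = pd μ f' p := by
  rw [pd, pd, (h.eventuallyEq_of_mem (hU.mem_nhds hp)).fderiv_eq]

lemma contDiffOn_pd {U : Set Coord} (hU : IsOpen U) {f : Coord → ℂ}
    (hf : ContDiffOn ℝ (⊤ : ℕ∞) f U) (μ : Fin 4) : ContDiffOn ℝ (⊤ : ℕ∞) (pd μ f) U :=
  (hf.fderiv_of_isOpen hU le_rfl).clm_apply contDiffOn_const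

lemma differentiableAt_of_contDiffOn {U : Set Coord} (hU : IsOpen U) {f : Coord → ℂ}
    (hf : ContDiffOn ℝ (⊤ : ℕ∞) f U) {p : Coord} (hp : p ∈ U) : DifferentiableAt ℝ f p :=
  (hf.contDiffAt (hU.mem_nhds hp)).differentiableAt (by simp)

/-- The algebra of smooth complex functions on `U`. Working on `U` instead of the whole coordinate
space makes equality on `U` an equality in a ring. -/
def SmoothFun (U : Set Coord) : Subalgebra ℂ (U → ℂ) where
  carrier := {f | ContDiffOn ℝ (⊤ : ℕ∞) (extendZero U f) U}
  mul_mem' {f f'} hf hf' := (hf.mul hf').congr fun p hp => by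
    simp only [extendZero_apply _ hp, Pi.mul_apply]
  add_mem' {f f'} hf hf' := (hf.add hf').congr fun p hp => by
    simp only [extendZero_apply _ hp, Pi.add_apply]
  algebraMap_mem' c := (contDiffOn_const (c := c)).congr fun p hp => by
    rw [extendZero_apply _ hp]; rfl

namespace SmoothFun

variable {U : Set Coord}

/-- The restriction to `U` of a function which is smooth on `U`. -/
def res (f : Coord → ℂ) (hf : ContDiffOn ℝ (⊤ : ℕ∞) f U) : SmoothFun U :=
  ⟨fun p => f p, hf.congr fun p hp => by rw [extendZero_apply _ hp]⟩

/-- Evaluation at a point of `U`. -/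
def eval (p : U) : SmoothFun U →ₐ[ℂ] ℂ :=
  (Pi.evalAlgHom ℂ (fun _ : U => ℂ) p).comp (SmoothFun U).val

lemma eval_res (p : U) (f : Coord → ℂ) (hf : ContDiffOn ℝ (⊤ : ℕ∞) f U) :
    eval p (res f hf) = f p := rfl

lemma ext_eval {f f' : SmoothFun U} (h : ∀ p, eval p f = eval p f') : f = f' :=
  Subtype.ext (funext h)

lemma extendZero_eq (f : SmoothFun U) {p : Coord} (hp : p ∈ U) :
    extendZero U f p = eval ⟨p, hp⟩ f := extendZero_apply _ hp

/-- The partial derivatives as derivations of the algebra of smooth functions. -/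
def deriv (hU : IsOpen U) (μ : Fin 4) : Derivation ℂ (SmoothFun U) (SmoothFun U) :=
  Derivation.mk'
    { toFun := fun f => res (pd μ (extendZero U f)) (contDiffOn_pd hU f.2 μ)
      map_add' := fun f f' => ext_eval fun p => by
        have h1 := pd_congr hU (f := extendZero U ((f + f' : SmoothFun U) : U → ℂ))
          (f' := extendZero U f + extendZero U f')
          (fun q hq => by simp only [Pi.add_apply, extendZero_eq _ hq, map_add]) μ p.2
        rw [map_add, eval_res, eval_res, eval_res, h1, pd,
          fderiv_add (differentiableAt_of_contDiffOn hU f.2 p.2)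
            (differentiableAt_of_contDiffOn hU f'.2 p.2)]
        rfl
      map_smul' := fun c f => ext_eval fun p => by
        have h1 := pd_congr hU (f := extendZero U ((c • f : SmoothFun U) : U → ℂ))
          (f' := c • extendZero U f)
          (fun q hq => by simp only [Pi.smul_apply, extendZero_eq _ hq, map_smul]) μ p.2
        rw [RingHom.id_apply, map_smul, eval_res, eval_res, h1, pd,
          fderiv_const_smul (differentiableAt_of_contDiffOn hU f.2 p.2)]
        rfl }
    fun f f' => ext_eval fun p => by
      have h1 := pd_congr hU (f := extendZero U ((f * f' : SmoothFun U) : U → ℂ))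
        (f' := extendZero U f * extendZero U f')
        (fun q hq => by simp only [Pi.mul_apply, extendZero_eq _ hq, map_mul]) μ p.2
      change pd μ (extendZero U ((f * f' : SmoothFun U) : U → ℂ)) p
        = eval p (f * res (pd μ (extendZero U f')) (contDiffOn_pd hU f'.2 μ)
          + f' * res (pd μ (extendZero U f)) (contDiffOn_pd hU f.2 μ))
      rw [map_add, map_mul, map_mul, eval_res, eval_res, h1, pd,
        fderiv_mul (differentiableAt_of_contDiffOn hU f.2 p.2)
          (differentiableAt_of_contDiffOn hU f'.2 p.2), extendZero_eq f p.2, extendZero_eq f' p.2]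
      rfl

lemma eval_deriv_res (hU : IsOpen U) (μ : Fin 4) (f : Coord → ℂ)
    (hf : ContDiffOn ℝ (⊤ : ℕ∞) f U) (p : U) : eval p (deriv hU μ (res f hf)) = pd μ f p :=
  pd_congr hU (fun q hq => by rw [extendZero_eq _ hq, eval_res]) μ p.2

/-- A function which agrees on `U` with a smooth function has the same partial derivatives. -/
lemma pd_eq_eval_deriv (hU : IsOpen U) (μ : Fin 4) {f : Coord → ℂ} {u : SmoothFun U}
    (h : ∀ p : U, f p = eval p u) (p : U) : pd μ f p = eval p (deriv hU μ u) :=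
  pd_congr hU (fun q hq => by rw [extendZero_eq _ hq, h ⟨q, hq⟩]) μ p.2

lemma deriv_comm (hU : IsOpen U) (μ ν : Fin 4) (f : SmoothFun U) :
    deriv hU μ (deriv hU ν f) = deriv hU ν (deriv hU μ f) := by
  refine ext_eval fun p => ?_
  have h0 : ∀ μ, ∀ q : U, pd μ (extendZero U f) q = eval q (deriv hU μ f) := fun μ q => rfl
  rw [← pd_eq_eval_deriv hU μ (h0 ν) p, ← pd_eq_eval_deriv hU ν (h0 μ) p]
  have h1 : ContDiffAt ℝ (⊤ : ℕ∞) (extendZero U f) p := f.2.contDiffAt (hU.mem_nhds p.2)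
  have h2 : IsSymmSndFDerivAt ℝ (extendZero U f) p := h1.isSymmSndFDerivAt (by
    rw [minSmoothness_of_isRCLikeNormedField]
    exact WithTop.coe_le_coe.mpr (le_top (a := (2 : ℕ∞))))
  have h3 : DifferentiableAt ℝ (fderiv ℝ (extendZero U f)) p :=
    ((f.2.fderiv_of_isOpen hU (m := (⊤ : ℕ∞)) le_rfl).contDiffAt
      (hU.mem_nhds p.2)).differentiableAt (by simp)
  have h4 : ∀ μ ν, pd μ (pd ν (extendZero U f)) p
      = fderiv ℝ (fderiv ℝ (extendZero U f)) p (Pi.single μ 1) (Pi.single ν 1) := by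
    intro μ ν
    have := fderiv_clm_apply h3 (differentiableAt_const (Pi.single ν (1 : ℝ)))
    rw [pd]
    unfold pd
    rw [this]
    simp
  rw [h4, h4, h2]

end SmoothFun

/-! ### The differential algebra of a self-dual brane -/

namespace PoissonBrane

variable (M : PoissonBrane)

/-- The metric with entries in the algebra of smooth functions. -/
def gFun : Matrix (Fin 4) (Fin 4) (SmoothFun M.U) :=
  Matrix.of fun i j => SmoothFun.res (fun p => M.g p i j) (M.g_smooth i j)

/-- The Poisson tensor with entries in the algebra of smooth functions. -/
def θFun : Matrix (Fin 4) (Fin 4) (SmoothFun M.U) :=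
  Matrix.of fun i j => SmoothFun.res (fun p => M.θ p i j) (M.θ_smooth i j)

/-- `σ` as an element of the algebra of smooth functions. -/
def σFun : SmoothFun M.U := SmoothFun.res M.σ M.σ_smooth

lemma contDiffOn_expσ : ContDiffOn ℝ (⊤ : ℕ∞) M.expσ M.U := M.σ_smooth.cexp

/-- `e^σ` as an element of the algebra of smooth functions. -/
def expFun : SmoothFun M.U := SmoothFun.res M.expσ M.contDiffOn_expσ

/-- `e^{-σ}` as an element of the algebra of smooth functions. -/
def expNegFun : SmoothFun M.U := SmoothFun.res (fun p => Complex.exp (-M.σ p)) M.σ_smooth.neg.cexp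

/-- `√g` as an element of the algebra of smooth functions. -/
def sqrtFun : SmoothFun M.U := SmoothFun.res M.sqrtG M.sqrtG_smooth

variable {M}

lemma eval_matrix_ext {m n : Type*} {P Q : Matrix m n (SmoothFun M.U)}
    (h : ∀ p, P.map (SmoothFun.eval p) = Q.map (SmoothFun.eval p)) : P = Q := by
  ext i j : 1
  exact SmoothFun.ext_eval fun p => Matrix.ext_iff.mpr (h p) i j

lemma gFun_map (p : M.U) : M.gFun.map (SmoothFun.eval p) = M.g p := rfl

lemma expFun_mul_expNegFun : M.expFun * M.expNegFun = 1 := SmoothFun.ext_eval fun p => by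
  rw [map_mul, map_one, expFun, expNegFun, SmoothFun.eval_res, SmoothFun.eval_res, expσ,
    ← Complex.exp_add, add_neg_cancel, Complex.exp_zero]

/-- Self-duality as a formula for the inverse metric. -/
lemma IsSelfDual.inv_g (hM : M.IsSelfDual) {p : Coord} (hp : p ∈ M.U) :
    (M.g p)⁻¹ = -(Complex.exp (-M.σ p) • (M.θ p * M.g p * M.θ p)) := by
  have h1 := hM p hp
  have h2 : IsUnit (effInvMetric M.g M.θ M.σ p).det := by
    rw [isUnit_iff_ne_zero]
    intro h0
    apply M.g_nondeg p hp
    rw [← h1, Matrix.det_nonsing_inv, h0, Ring.inverse_zero]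
  rw [← h1, Matrix.nonsing_inv_nonsing_inv _ h2, h1, effInvMetric, M.θ_antisymm p hp, mul_neg,
    smul_neg]

lemma map_smul_mul_mul (p : M.U) (c : SmoothFun M.U)
    (P Q R : Matrix (Fin 4) (Fin 4) (SmoothFun M.U)) :
    (-(c • (P * Q * R))).map (SmoothFun.eval p)
      = -(SmoothFun.eval p c • (P.map (SmoothFun.eval p) * Q.map (SmoothFun.eval p) *
          R.map (SmoothFun.eval p))) := by
  ext i j
  simp [Matrix.mul_apply]

lemma IsSelfDual.map_h (hM : M.IsSelfDual) (p : M.U) :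
    (-(M.expNegFun • (M.θFun * M.gFun * M.θFun))).map (SmoothFun.eval p) = (M.g p)⁻¹ := by
  rw [map_smul_mul_mul, hM.inv_g p.2]
  rfl

lemma IsSelfDual.gFun_mul_h (hM : M.IsSelfDual) :
    M.gFun * -(M.expNegFun • (M.θFun * M.gFun * M.θFun)) = 1 := eval_matrix_ext fun p => by
  rw [Matrix.map_mul, hM.map_h, gFun_map,
    Matrix.mul_nonsing_inv _ (isUnit_iff_ne_zero.mpr (M.g_nondeg p p.2)),
    Matrix.map_one _ (map_zero _) (map_one _)]

/-- The algebraic model of a self-dual brane. -/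
def IsSelfDual.model (hM : M.IsSelfDual) : SelfDualPoisson (SmoothFun M.U) where
  d := SmoothFun.deriv M.isOpen_U
  g := M.gFun
  h := -(M.expNegFun • (M.θFun * M.gFun * M.θFun))
  θ := M.θFun
  ω := -(M.expNegFun • (M.gFun * M.θFun * M.gFun))
  σ := M.σFun
  E := M.expFun
  E' := M.expNegFun
  d_comm := SmoothFun.deriv_comm M.isOpen_U
  g_symm := eval_matrix_ext fun p => M.g_symm p p.2
  θ_antisymm := eval_matrix_ext fun p => by
    rw [Matrix.map_neg _ (map_neg _)]
    exact M.θ_antisymm p p.2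
  g_mul_h := hM.gFun_mul_h
  θ_mul_ω := by
    rw [← mul_eq_one_comm.mp hM.gFun_mul_h, Matrix.mul_neg, Matrix.neg_mul, Matrix.mul_smul,
      Matrix.smul_mul]
    simp only [mul_assoc]
  E_mul_E' := expFun_mul_expNegFun
  d_E k := SmoothFun.ext_eval fun p => by
    have h1 := (differentiableAt_of_contDiffOn M.isOpen_U M.σ_smooth p.2).hasFDerivAt.cexp
    rw [expFun, σFun, map_mul, SmoothFun.eval_deriv_res, SmoothFun.eval_deriv_res,
      SmoothFun.eval_res, pd, pd]
    rw [show M.expσ = fun q => Complex.exp (M.σ q) from rfl, h1.fderiv]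
    rfl
  selfDual := by
    rw [smul_neg, neg_neg, smul_smul, expFun_mul_expNegFun, one_smul]
  jacobi l m n := SmoothFun.ext_eval fun p => by
    rw [map_zero, ← M.θ_jacobi p p.2 l m n]
    simp only [map_sum, map_add, map_mul, θFun, Matrix.of_apply, SmoothFun.eval_deriv_res]
    rfl

namespace IsSelfDual

variable (hM : M.IsSelfDual) (p : M.U)

lemma eval_h (i j : Fin 4) : (M.g p)⁻¹ i j = SmoothFun.eval p (hM.model.h i j) :=
  (Matrix.ext_iff.mpr (hM.map_h p) i j).symm

lemma pd_eq (μ : Fin 4) {f : Coord → ℂ} {u : SmoothFun M.U}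
    (h : ∀ p : M.U, f p = SmoothFun.eval p u) :
    pd μ f p = SmoothFun.eval p (hM.model.d μ u) :=
  SmoothFun.pd_eq_eval_deriv M.isOpen_U μ h p

lemma christoffel_eq (l m n : Fin 4) :
    christoffel M.g l m n p = SmoothFun.eval p (hM.model.Γ m l n) := by
  have h1 : ∀ k i j, pd k (fun q => M.g q i j) p
      = SmoothFun.eval p (hM.model.d k (hM.model.g i j)) := fun k i j =>
    hM.pd_eq p k fun q => rfl
  simp only [christoffel, SelfDualPoisson.Γ, Matrix.of_apply, map_mul, map_sum, map_sub, map_add,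
    h1, hM.eval_h, AlgHom.commutes]
  rfl

lemma riemannUp_eq (n m l k : Fin 4) :
    riemannUp M.g n m l k p = SmoothFun.eval p (hM.model.riemannUp n m l k) := by
  have h1 : ∀ i k m l, pd i (christoffel M.g k m l) p
      = SmoothFun.eval p (hM.model.d i (hM.model.Γ m k l)) := fun i k m l =>
    hM.pd_eq p i fun q => hM.christoffel_eq q k m l
  simp only [riemannUp, h1, hM.christoffel_eq, SelfDualPoisson.riemannUp, SelfDualPoisson.curv,
    Matrix.sub_apply, Matrix.add_apply, Matrix.mul_apply, Derivation.mat_apply, map_neg, map_sub,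
    map_add, map_sum, map_mul, Finset.sum_sub_distrib]
  ring

lemma riemann_eq (n m l k : Fin 4) :
    riemann M.g n m l k p = SmoothFun.eval p (hM.model.riemann n m l k) := by
  simp only [riemann, hM.riemannUp_eq, SelfDualPoisson.riemann, map_sum, map_mul]
  rfl

lemma scalarCurv_eq : scalarCurv M.g p = SmoothFun.eval p hM.model.scalarCurv := by
  simp only [scalarCurv, ricci, hM.riemannUp_eq, hM.eval_h, SelfDualPoisson.scalarCurv, map_sum,
    map_mul]

lemma laplaceBeltrami_eq {f : Coord → ℂ} {u : SmoothFun M.U}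
    (h : ∀ p : M.U, f p = SmoothFun.eval p u) :
    laplaceBeltrami M.g f p = SmoothFun.eval p (hM.model.laplacian u) := by
  simp only [laplaceBeltrami, hM.pd_eq _ _ h, hM.pd_eq p _ (fun q => hM.pd_eq q _ h), hM.eval_h,
    hM.christoffel_eq, SelfDualPoisson.laplacian, SelfDualPoisson.hess, map_sum, map_mul, map_sub]

lemma gradSq_eq {f : Coord → ℂ} {u : SmoothFun M.U}
    (h : ∀ p : M.U, f p = SmoothFun.eval p u) :
    gradSq M.g f p = SmoothFun.eval p (hM.model.gradSq u) := by
  simp only [gradSq, hM.pd_eq _ _ h, hM.eval_h, SelfDualPoisson.gradSq, map_sum, map_mul]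

lemma poissonBracket_eq {f f' : Coord → ℂ} {u u' : SmoothFun M.U}
    (h : ∀ p : M.U, f p = SmoothFun.eval p u) (h' : ∀ p : M.U, f' p = SmoothFun.eval p u') :
    poissonBracket M.θ f f' p = SmoothFun.eval p (hM.model.bracket u u') := by
  simp only [poissonBracket, hM.pd_eq _ _ h, hM.pd_eq _ _ h', SelfDualPoisson.bracket, map_sum,
    map_mul]
  rfl

lemma symbol_eq {D : ℕ} {x : Fin D → Coord → ℂ} {u : Fin D → SmoothFun M.U}
    (h : ∀ a, ∀ p : M.U, x a p = SmoothFun.eval p (u a)) (O : MatrixObs D) :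
    O.symbol M.θ x p = SmoothFun.eval p (hM.model.symbol u O) := by
  induction O generalizing p with
  | X a => exact h a p
  | smul c O ih => simp only [MatrixObs.symbol, SelfDualPoisson.symbol, map_smul, ih, smul_eq_mul]
  | add O P ih ih' => simp only [MatrixObs.symbol, SelfDualPoisson.symbol, map_add, ih, ih']
  | sum O ih => simp only [MatrixObs.symbol, SelfDualPoisson.symbol, map_sum, ih]
  | mul O P ih ih' => simp only [MatrixObs.symbol, SelfDualPoisson.symbol, map_mul, ih, ih']
  | comm O P ih ih' =>
    simp only [MatrixObs.symbol, SelfDualPoisson.symbol, map_smul, smul_eq_mul,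
      hM.poissonBracket_eq p ih ih']

/-- The algebraic model of an embedding. -/
def embedding {D : ℕ} {η : Matrix (Fin D) (Fin D) ℝ} {x : Fin D → Coord → ℂ}
    (hx : M.IsEmbedding η x) : hM.model.Embedding D where
  η := Matrix.of fun a b => algebraMap ℂ (SmoothFun M.U) (η a b)
  x a := SmoothFun.res (x a) (hx.x_smooth a)
  η_symm := by
    ext a b : 1
    rw [Matrix.transpose_apply, Matrix.of_apply, Matrix.of_apply,
      show η b a = η a b from Matrix.ext_iff.mpr hx.η_symm a b]
  d_η k := by ext a b : 1; simp
  induced m n := SmoothFun.ext_eval fun p => by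
    have h1 : ∀ k a, SmoothFun.eval p (hM.model.d k (SmoothFun.res (x a) (hx.x_smooth a)))
        = pd k (x a) p := fun k a => (hM.pd_eq p k fun q => rfl).symm
    simp only [map_sum, map_mul, Matrix.of_apply, AlgHom.commutes, h1]
    exact hx.induced p p.2 m n

lemma sqrtFun_sq : M.sqrtFun ^ 2 = hM.model.g.det := SmoothFun.ext_eval fun p => by
  rw [map_pow, AlgHom.map_det]
  refine (M.sqrtG_sq p p.2).trans ?_
  rw [hM p p.2]
  rfl

lemma rho_mul_exp : SmoothFun.res M.rho M.rho_smooth * hM.model.E = M.sqrtFun :=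
  SmoothFun.ext_eval fun p => by
    have h1 := M.exp_neg_σ p p.2
    have h2 : M.sqrtG p ≠ 0 := by
      intro h0
      rw [h0, div_zero] at h1
      exact Complex.exp_ne_zero _ h1
    have h3 : M.rho p = Complex.exp (-M.σ p) * M.sqrtG p := by
      rw [h1, div_mul_cancel₀ _ h2]
    change M.rho p * Complex.exp (M.σ p) = M.sqrtG p
    rw [h3, mul_right_comm, ← Complex.exp_add, neg_add_cancel, Complex.exp_zero, one_mul]

/-- The divergence of `√g ∂^μ e^σ`. -/
def divGradExp : SmoothFun M.U := M.sqrtFun * hM.model.laplacian hM.model.E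

/-- `√g ∂^μ e^σ` with values in the algebra of smooth functions. -/
def gradExpFun (μ : Fin 4) : SmoothFun M.U :=
  M.sqrtFun * ∑ ν, hM.model.h μ ν * hM.model.d ν hM.model.E

lemma gradExpσ_eq (μ : Fin 4) : M.gradExpσ p μ = SmoothFun.eval p (hM.gradExpFun μ) := by
  have h1 : ∀ ν, pd ν M.expσ p = SmoothFun.eval p (hM.model.d ν hM.model.E) := fun ν =>
    hM.pd_eq p ν fun q => rfl
  simp only [gradExpσ, gradExpFun, h1, hM.eval_h, map_mul, map_sum]
  rfl

lemma sum_pd_gradExpσ :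
    ∑ μ, pd μ (fun q => M.gradExpσ q μ) p = SmoothFun.eval p hM.divGradExp := by
  rw [divGradExp, ← hM.model.sum_d_sqrt_mul_grad hM.sqrtFun_sq, map_sum]
  exact Finset.sum_congr rfl fun μ _ => hM.pd_eq p μ fun q => hM.gradExpσ_eq q μ

/-- The pointwise form of the reduction of the action. -/
theorem traceDensity_eq (hM : M.IsSelfDual) (p : M.U) {D : ℕ}
    {η : Matrix (Fin D) (Fin D) ℝ} {x : Fin D → Coord → ℂ} (hx : M.IsEmbedding η x) (α β : ℂ) :
    M.traceDensity x (.orderSix η α β) p = (α + β) * M.extrinsicDensity η x p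
      + β * (M.intrinsicDensity p - ∑ μ, pd μ (fun q => M.gradExpσ q μ) p) := by
  have h1 := congrArg (SmoothFun.eval p) ((hM.embedding hx).rho_mul_symbol_orderSix (η := η)
    (fun a b => rfl) α β hM.rho_mul_exp)
  have h2 : ∀ a, ∀ q : M.U, x a q = SmoothFun.eval q ((hM.embedding hx).x a) := fun a q => rfl
  have h3 : M.traceDensity x (.orderSix η α β) p = SmoothFun.eval p
      (SmoothFun.res M.rho M.rho_smooth *
        hM.model.symbol (hM.embedding hx).x (.orderSix η α β)) := by
    rw [traceDensity, hM.symbol_eq p h2, map_mul]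
    rfl
  rw [h3, h1, hM.sum_pd_gradExpσ, divGradExp, intrinsicDensity, extrinsicDensity,
    hM.scalarCurv_eq, hM.gradSq_eq p (u := M.σFun) fun q => rfl]
  simp only [hM.laplaceBeltrami_eq p (h2 _), hM.riemann_eq, SelfDualPoisson.Embedding.boxSq,
    map_add, map_mul, map_sub, map_sum, AlgHom.commutes, map_ofNat]
  rfl

end IsSelfDual
end PoissonBrane

/-! ### The integral of a divergence -/

open MeasureTheory in
lemma integrable_mul_of_tsupport_subset {U : Set Coord} (hU : IsOpen U) {f χ : Coord → ℂ}
    (hf : ContinuousOn f U) (hχ : Continuous χ) (hc : HasCompactSupport χ)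
    (hs : tsupport χ ⊆ U) : Integrable fun p => f p * χ p := by
  have h1 : tsupport (fun p => f p * χ p) ⊆ tsupport χ := tsupport_mul_subset_right
  have h2 : Continuous fun p => f p * χ p :=
    (hf.mul hχ.continuousOn).continuous_of_tsupport_subset hU (h1.trans hs)
  exact h2.integrable_of_hasCompactSupport hc.mul_left

open MeasureTheory in
/-- Integration by parts against a cut-off with compact support in `U`. -/
lemma setIntegral_mul_pd_eq_neg {U : Set Coord} (hU : IsOpen U) {f χ : Coord → ℂ}
    (hf : ContDiffOn ℝ (⊤ : ℕ∞) f U) (hχ : ContDiff ℝ (⊤ : ℕ∞) χ) (hc : HasCompactSupport χ)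
    (hs : tsupport χ ⊆ U) (μ : Fin 4) :
    IntegrableOn (fun p => f p * pd μ χ p) U ∧ IntegrableOn (fun p => pd μ f p * χ p) U ∧
      ∫ p in U, f p * pd μ χ p = -∫ p in U, pd μ f p * χ p := by
  have hpd : tsupport (pd μ χ) ⊆ tsupport χ := tsupport_fderiv_apply_subset ℝ _
  have hpdc : Continuous (pd μ χ) := (hχ.continuous_fderiv (by simp)).clm_apply continuous_const
  have i1 : Integrable fun p => f p * pd μ χ p :=
    integrable_mul_of_tsupport_subset hU hf.continuousOn hpdc (hc.mono' (subset_closure.trans hpd))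
      (hpd.trans hs)
  have i2 : Integrable fun p => pd μ f p * χ p :=
    integrable_mul_of_tsupport_subset hU (contDiffOn_pd hU hf μ).continuousOn hχ.continuous hc hs
  have i3 : Integrable fun p => f p * χ p :=
    integrable_mul_of_tsupport_subset hU hf.continuousOn hχ.continuous hc hs
  refine ⟨i1.integrableOn, i2.integrableOn, ?_⟩
  have h0 : ∀ p, p ∉ U → χ p = 0 := fun p hp => image_eq_zero_of_notMem_tsupport fun h => hp (hs h)
  have h0' : ∀ p, p ∉ U → pd μ χ p = 0 := fun p hp =>
    image_eq_zero_of_notMem_tsupport fun h => hp (hs (hpd h))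
  rw [setIntegral_eq_integral_of_forall_compl_eq_zero fun p hp => by rw [h0' p hp, mul_zero],
    setIntegral_eq_integral_of_forall_compl_eq_zero fun p hp => by rw [h0 p hp, mul_zero]]
  exact integral_mul_fderiv_eq_neg_fderiv_mul_of_integrable i2 i1 i3
    (fun p hp => differentiableAt_of_contDiffOn hU hf (hs hp))
    (fun p _ => hχ.differentiable (by simp) p)

open MeasureTheory in
/-- An integrable divergence of a vector density without boundary flux integrates to zero. -/
theorem integral_div_eq_zero_of_noBoundaryFlux {U : Set Coord} (hU : IsOpen U)
    {W : Coord → Fin 4 → ℂ} (hW : ∀ μ, ContDiffOn ℝ (⊤ : ℕ∞) (fun p => W p μ) U)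
    (hflux : NoBoundaryFlux U W)
    (hint : IntegrableOn (fun p => ∑ μ, pd μ (fun q => W q μ) p) U) :
    ∫ p in U, ∑ μ, pd μ (fun q => W q μ) p = 0 := by
  obtain ⟨χ, hχ, hbound, hlim, hzero⟩ := hflux
  have hsm : ∀ k, ContDiff ℝ (⊤ : ℕ∞) fun q => (χ k q : ℂ) := fun k =>
    Complex.ofRealCLM.contDiff.comp (hχ k).1
  have hts : ∀ k, tsupport (fun q => (χ k q : ℂ)) ⊆ tsupport (χ k) := fun k =>
    tsupport_comp_subset Complex.ofReal_zero (χ k)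
  have hcs : ∀ k, HasCompactSupport fun q => (χ k q : ℂ) := fun k =>
    (hχ k).2.1.comp_left Complex.ofReal_zero
  have hparts := fun k μ => setIntegral_mul_pd_eq_neg hU (hW μ) (hsm k) (hcs k)
    ((hts k).trans (hχ k).2.2) μ
  have h1 : ∀ k, ∫ p in U, (∑ μ, pd μ (fun q => W q μ) p) * (χ k p : ℂ)
      = -∫ p in U, ∑ μ, W p μ * pd μ (fun q => (χ k q : ℂ)) p := by
    intro k
    simp only [Finset.sum_mul]
    rw [integral_finsetSum _ fun μ _ => (hparts k μ).2.1,
      integral_finsetSum _ fun μ _ => (hparts k μ).1, ← Finset.sum_neg_distrib]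
    exact Finset.sum_congr rfl fun μ _ => by rw [(hparts k μ).2.2, neg_neg]
  have h2 : Filter.Tendsto (fun k => ∫ p in U, (∑ μ, pd μ (fun q => W q μ) p) * (χ k p : ℂ))
      Filter.atTop (nhds 0) := by
    simp only [h1]
    simpa using hzero.neg
  have h3 : Filter.Tendsto (fun k => ∫ p in U, (∑ μ, pd μ (fun q => W q μ) p) * (χ k p : ℂ))
      Filter.atTop (nhds (∫ p in U, ∑ μ, pd μ (fun q => W q μ) p)) := by
    refine tendsto_integral_of_dominated_convergence
      (fun p => ‖∑ μ, pd μ (fun q => W q μ) p‖) (fun k => ?_) hint.norm (fun k => ?_) ?_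
    · exact hint.aestronglyMeasurable.mul (hsm k).continuous.aestronglyMeasurable
    · refine Filter.Eventually.of_forall fun p => ?_
      rw [norm_mul, Complex.norm_real, Real.norm_of_nonneg (hbound k p).1]
      exact mul_le_of_le_one_right (norm_nonneg _) (hbound k p).2
    · refine (ae_restrict_iff' hU.measurableSet).mpr (Filter.Eventually.of_forall fun p hp => ?_)
      have h4 : Filter.Tendsto (fun k => (χ k p : ℂ)) Filter.atTop (nhds ((1 : ℝ) : ℂ)) :=
        (Complex.continuous_ofReal.tendsto 1).comp (hlim p hp)
      simpa using h4.const_mul (∑ μ, pd μ (fun q => W q μ) p)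
  exact tendsto_nhds_unique h3 h2

/-! ### The reduced action -/

namespace PoissonBrane

variable {M : PoissonBrane}

lemma IsSelfDual.contDiffOn_gradExpσ (hM : M.IsSelfDual) (μ : Fin 4) :
    ContDiffOn ℝ (⊤ : ℕ∞) (fun p => M.gradExpσ p μ) M.U :=
  ContDiffOn.congr (hM.gradExpFun μ).2 fun p hp => by
    rw [SmoothFun.extendZero_eq _ hp, hM.gradExpσ_eq ⟨p, hp⟩ μ]

open MeasureTheory in
/-- The reduction formula. For integrability of the extrinsic term only its multiple by `α + β`
matters, which covers the case `α + β = 0` without further assumptions. -/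
lemma IsSelfDual.semiclassicalTrace_orderSix (hM : M.IsSelfDual) (α β : ℂ)
    (hflux : NoBoundaryFlux M.U M.gradExpσ) (hI : IntegrableOn M.intrinsicDensity M.U)
    {D : ℕ} {η : Matrix (Fin D) (Fin D) ℝ} {x : Fin D → Coord → ℂ} (hx : M.IsEmbedding η x)
    (hT : IntegrableOn (M.traceDensity x (MatrixObs.orderSix η α β)) M.U)
    (hE : IntegrableOn (fun p => (α + β) * M.extrinsicDensity η x p) M.U) :
    M.semiclassicalTrace x (MatrixObs.orderSix η α β)
      = (α + β) / (2 * (Real.pi : ℂ)) ^ 2 * (∫ p in M.U, M.extrinsicDensity η x p)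
        + β / (2 * (Real.pi : ℂ)) ^ 2 * ∫ p in M.U, M.intrinsicDensity p := by
  set W : Coord → ℂ := fun p => ∑ μ, pd μ (fun q => M.gradExpσ q μ) p
  have hU := M.isOpen_U.measurableSet
  have h1 : Set.EqOn (M.traceDensity x (MatrixObs.orderSix η α β))
      (fun p => (α + β) * M.extrinsicDensity η x p + (β * M.intrinsicDensity p - β * W p)) M.U :=
    fun p hp => (hM.traceDensity_eq ⟨p, hp⟩ hx α β).trans (by rw [mul_sub])
  have hβI : IntegrableOn (fun p => β * M.intrinsicDensity p) M.U := hI.const_mul β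
  -- The divergence is integrable because all the other terms are, unless `β = 0`.
  have hβW : IntegrableOn (fun p => β * W p) M.U := by
    refine ((hE.add hβI).sub hT).congr_fun (fun p hp => ?_) hU
    simp only [Pi.sub_apply, Pi.add_apply, h1 hp]
    ring
  have hzero : ∫ p in M.U, β * W p = 0 := by
    rcases eq_or_ne β 0 with rfl | hβ
    · simp
    · have hW : IntegrableOn W M.U := by
        have h2 := hβW.const_mul β⁻¹
        simp only [inv_mul_cancel_left₀ hβ] at h2
        exact h2
      rw [integral_const_mul, integral_div_eq_zero_of_noBoundaryFlux M.isOpen_U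
        hM.contDiffOn_gradExpσ hflux hW, mul_zero]
  have hβIW : IntegrableOn (fun p => β * M.intrinsicDensity p - β * W p) M.U := hβI.sub hβW
  rw [semiclassicalTrace, setIntegral_congr_fun hU h1, integral_add hE hβIW,
    integral_sub hβI hβW, hzero, sub_zero, integral_const_mul, integral_const_mul]
  ring

end PoissonBrane

end

theorem mainTheorem3 (M : PoissonBrane) (hGg : M.IsSelfDual) (α β : ℂ) :
    -- the semi-classical limit of `S₆`
    (NoBoundaryFlux M.U M.gradExpσ →
      MeasureTheory.IntegrableOn M.intrinsicDensity M.U →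
      ∀ (D : ℕ) (η : Matrix (Fin D) (Fin D) ℝ) (x : Fin D → Coord → ℂ),
        M.IsEmbedding η x →
        MeasureTheory.IntegrableOn (M.traceDensity x (MatrixObs.orderSix η α β)) M.U →
        MeasureTheory.IntegrableOn (M.extrinsicDensity η x) M.U →
        M.semiclassicalTrace x (MatrixObs.orderSix η α β)
          = (α + β) / (2 * (Real.pi : ℂ)) ^ 2 * (∫ p in M.U, M.extrinsicDensity η x p)
            + β / (2 * (Real.pi : ℂ)) ^ 2 * ∫ p in M.U, M.intrinsicDensity p) ∧
    -- for `α + β = 0` it is purely intrinsic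
    (α + β = 0 →
      NoBoundaryFlux M.U M.gradExpσ →
      MeasureTheory.IntegrableOn M.intrinsicDensity M.U →
      ∀ (D : ℕ) (η : Matrix (Fin D) (Fin D) ℝ) (x : Fin D → Coord → ℂ),
        M.IsEmbedding η x →
        MeasureTheory.IntegrableOn (M.traceDensity x (MatrixObs.orderSix η α β)) M.U →
        M.semiclassicalTrace x (MatrixObs.orderSix η α β)
          = β / (2 * (Real.pi : ℂ)) ^ 2 * ∫ p in M.U, M.intrinsicDensity p) ∧
    -- and does not depend on the embedding
    (α + β = 0 →
      ∀ (D D' : ℕ) (η : Matrix (Fin D) (Fin D) ℝ) (η' : Matrix (Fin D') (Fin D') ℝ)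
        (x : Fin D → Coord → ℂ) (x' : Fin D' → Coord → ℂ),
        M.IsEmbedding η x → M.IsEmbedding η' x' →
        M.semiclassicalTrace x (MatrixObs.orderSix η α β)
          = M.semiclassicalTrace x' (MatrixObs.orderSix η' α β)) := by
  refine ⟨fun hflux hI D η x hx hT hE =>
      hGg.semiclassicalTrace_orderSix α β hflux hI hx hT (hE.const_mul _),
    fun h0 hflux hI D η x hx hT => ?_, fun h0 D D' η η' x x' hx hx' => ?_⟩
  · -- The extrinsic term need not be integrable here; its coefficient vanishes identically.
    have hE : MeasureTheory.IntegrableOn (fun p => (α + β) * M.extrinsicDensity η x p) M.U := by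
      simp only [h0, zero_mul]
      exact MeasureTheory.integrableOn_zero
    rw [hGg.semiclassicalTrace_orderSix α β hflux hI hx hT hE, h0, zero_div, zero_mul, zero_add]
  · -- The two densities agree pointwise on `U`.
    rw [PoissonBrane.semiclassicalTrace, PoissonBrane.semiclassicalTrace]
    congr 1
    refine MeasureTheory.setIntegral_congr_fun M.isOpen_U.measurableSet fun p hp => ?_
    have h1 := hGg.traceDensity_eq ⟨p, hp⟩ hx α β
    have h2 := hGg.traceDensity_eq ⟨p, hp⟩ hx' α β
    rw [h0, zero_mul, zero_add] at h1 h2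
    exact h1.trans h2.symm
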